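/- Let $p$ be a prime, $m,s\ge 1$ integers, and let $R=GR(p^2,m)$ be the Galois ring of characteristic $p^2$ with $p^{2m}$ elements, i.e. the finite commutative local ring of characteristic $p^2$ with $p^{2m}$ elements whose maximal ideal is $\langle p\rangle$; its residue field is $\mathbb F_{p^m}$. Let $\mathcal T_m\subset R$ be the Teichmüller set ($0$ together with the $(p^m-1)$-th roots of unity). Cyclic codes of length $p^s$ over $R$ (or $\mathbb F_{p^m}$) are the ideals of $R[x]/\langle x^{p^s}-1\rangle$ (or $\mathbb F_{p^m}[x]/\langle x^{p^s}-1\rangle$). The Hamming distance $d_H$ of a nonzero code is the least number of nonzero coefficients of a nonzero codeword, codewords being written as polynomials of degree $<p^s$. Let $\mu$ be coefficientwise reduction modulo $p$. For an ideal $C$ and $i\in\{0,1\}$ put $\mathrm{Tor}_i(C)=\{\mu(v): p^iv\in C\}$; then $\mathrm{Tor}_i(C)=\langle (x-1)^{T_i(C)}\rangle$ for some $0\le T_i(C)\le p^s$, the $i$-th torsional degree of $C$. For $0\le i\le p-2$ let $\gamma_{ip^{s-1}}\in\mathcal T_m$ be the element congruent to $\frac1p\binom{p^s}{(i+1)p^{s-1}}$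 modulo $p$, and let $\gamma_j=0$ for all other $j\ge 0$. (Thus $x^{p^s}-1=(x-1)^{p^s}+p(x-1)^{p^{s-1}}\sum_j\gamma_j(x-1)^j$ in $R[x]$.) Throughout, $k,\ell,n$ are nonnegative integers less than $p^s$; $n<k$ whenever $k$ and $n$ both occur; and, whenever $\ell$ and $\delta$ occur, $\ell<k$ and $\delta=\sum_{j=0}^{k-1-\ell}\eta_j(x-1)^j$ with $\eta_j\in\mathcal T_m$, $\eta_0\ne 0$, where we put $\eta_j=0$ for $j\ge k-\ell$ and $z=\min(\{j:\gamma_j\neq\eta_j\}\cup\{p^s\})$. **Forms.** Every ideal $C$ of $R[x]/\langle x^{p^s}-1\rangle$ has one of the forms $\langle 0\rangle$, $\langle 1\rangle$, $\langle p(x-1)^n\rangle$, $\langle (x-1)^k\rangle$, $\langle (x-1)^k+p(x-1)^\ell\delta\rangle$, $\langle (x-1)^k,\,p(x-1)^n\rangle$, $\langle (x-1)^k+p(x-1)^\ell\delta,\,p(x-1)^n\rangle$. **Torsional degrees.** 1. If $C=\langle (x-1)^k\rangle$, then $T_0(C)=k$ and $T_1(C)=\min(k,p^{s-1})$. 2.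 If $C=\langle (x-1)^k+p(x-1)^\ell\delta\rangle$, then $T_0(C)=k$ and $T_1(C)=\min(k,p^{s-1},p^s-k+\ell)$ if $p^{s-1}\ne p^s-k+\ell$, while $T_1(C)=\min(k,p^{s-1}+z)$ if $p^{s-1}=p^s-k+\ell$. 3. If $C=\langle (x-1)^k,\,p(x-1)^n\rangle$, then $T_0(C)=k$ and $T_1(C)=\min(k,p^{s-1},n)$. 4. If $C=\langle (x-1)^k+p(x-1)^\ell\delta,\,p(x-1)^n\rangle$, then $T_0(C)=k$ and $T_1(C)=\min(k,p^{s-1},p^s-k+\ell,n)$ if $p^{s-1}\neq p^s-k+\ell$, while $T_1(C)=\min(k,p^{s-1}+z,n)$ if $p^{s-1}=p^s-k+\ell$. 5. If $C=\langle p(x-1)^n\rangle$, then $T_0(C)=p^s$ and $T_1(C)=n$. **Hamming distance.** For every nonzero ideal $C$, $d_H(C)=d_H(\langle (x-1)^{T_1(C)}\rangle)$, where the code on the right is over $\mathbb F_{p^m}$. Moreover, for $0\le i<p^s$, the distance $d_H(\langle (x-1)^i\rangle)$ over $\mathbb F_{p^m}$ is - $1$ if $i=0$; - $2$ if $1\le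 i\le p^{s-1}$; - $\beta+2$ if $\beta p^{s-1}+1\le i\le(\beta+1)p^{s-1}$ with $1\le\beta\le p-2$; - $(\tau+1)p^{r}$ if $p^s-p^{s-r}+(\tau-1)p^{s-r-1}+1\le i\le p^s-p^{s-r}+\tau p^{s-r-1}$ with $1\le\tau\le p-1$ and $1\le r\le s-1$. -/

import Mathlib

open Polynomial

/-- `R` is the Galois ring `GR(p^a, m)`: the (unique up to isomorphism) finite commutative local ring
of characteristic `p^a` with `p^(a m)` elements whose maximal ideal is generated by `p`. -/
structure IsGaloisRing (p a m : ℕ) (R : Type*) [CommRing R] [IsLocalRing R] : Prop where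
  charP : CharP R (p ^ a)
  maximalIdeal_eq : IsLocalRing.maximalIdeal R = Ideal.span {(p : R)}
  card_eq : Nat.card R = p ^ (a * m)

/-- The Teichmüller set `{0, 1, ζ, …, ζ^(p^m - 2)}` of `GR(p^a, m)`, where `ζ` is an element of
multiplicative order `p^m - 1`: zero together with the `(p^m - 1)`-th roots of unity. -/
def teichmullerSet (p m : ℕ) (R : Type*) [CommRing R] : Set R :=
  {r | r = 0 ∨ r ^ (p ^ m - 1) = 1}

/-- The Teichmüller representative of `r` modulo `p` in a Galois ring of characteristic `p^2`;
see `teichmullerRep_mem` and `residue_teichmullerRep`. -/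
def teichmullerRep (p m : ℕ) {R : Type*} [CommRing R] (r : R) : R := r ^ (p ^ m)

/-- The ring `R[x] / ⟨x^N - 1⟩`, whose ideals are the cyclic codes of length `N` over `R`. -/
abbrev CyclicAmbient (R : Type*) [CommRing R] (N : ℕ) : Type _ :=
  AdjoinRoot (X ^ N - 1 : R[X])

/-- The class of `x - 1` in `R[x] / ⟨x^N - 1⟩`. -/
noncomputable def xSubOne (R : Type*) [CommRing R] (N : ℕ) : CyclicAmbient R N :=
  AdjoinRoot.mk (X ^ N - 1 : R[X]) (X - 1)

/-- The Hamming distance of a cyclic code: the least number of nonzero coefficients of a nonzero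
codeword, codewords being identified with polynomials of degree less than `N`.
(For the zero code, which has no nonzero codeword, the value is `0` by convention.) -/
noncomputable def hammingDistance {R : Type*} [CommRing R] {N : ℕ}
    (C : Ideal (CyclicAmbient R N)) : ℕ :=
  sInf {w | ∃ f : R[X], f ≠ 0 ∧ f.degree < (N : WithBot ℕ) ∧
    AdjoinRoot.mk (X ^ N - 1 : R[X]) f ∈ C ∧ f.support.card = w}

/-- The canonical projection `μ`, which reduces the coefficients to the residue field. -/
noncomputable def reduction (R : Type*) [CommRing R] [IsLocalRing R] (N : ℕ) :
    CyclicAmbient R N →+* CyclicAmbient (IsLocalRing.ResidueField R) N :=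
  AdjoinRoot.map (IsLocalRing.residue R) _ _ (by simp)

/-- The `i`-th torsion code `Tor_i(C) = {μ(v) : p^i v ∈ C}`. -/
def torsionCode (p : ℕ) {R : Type*} [CommRing R] [IsLocalRing R] {N : ℕ} (i : ℕ)
    (C : Ideal (CyclicAmbient R N)) : Set (CyclicAmbient (IsLocalRing.ResidueField R) N) :=
  {w | ∃ v : CyclicAmbient R N, (p : CyclicAmbient R N) ^ i * v ∈ C ∧ reduction R N v = w}

/-- The `i`-th torsional degree `T_i(C)`: the exponent `T ≤ N` for which
`Tor_i(C) = ⟨(x - 1)^T⟩` (here `N` is a power of `p`). -/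
noncomputable def torsionalDegree (p : ℕ) {R : Type*} [CommRing R] [IsLocalRing R] {N : ℕ} (i : ℕ)
    (C : Ideal (CyclicAmbient R N)) : ℕ :=
  sInf {T | T ≤ N ∧ torsionCode p i C =
    (Ideal.span {xSubOne (IsLocalRing.ResidueField R) N ^ T} : Set _)}

/-- The coefficients `γ_j ∈ T_m` with
`x^(p^s) - 1 = (x-1)^(p^s) + p (x-1)^(p^(s-1)) ∑_j γ_j (x-1)^j` over `GR(p^2, m)`:
for `j = i p^(s-1)` with `0 ≤ i ≤ p - 2`, `γ_j` is the Teichmüller representative of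
`binom(p^s, (i+1) p^(s-1)) / p` modulo `p`; all other `γ_j` are zero. -/
def gammaCoeff (p m s : ℕ) (R : Type*) [CommRing R] (j : ℕ) : R :=
  if p ^ (s - 1) ∣ j ∧ j / p ^ (s - 1) + 2 ≤ p then
    teichmullerRep p m
      (((p ^ s).choose ((j / p ^ (s - 1) + 1) * p ^ (s - 1)) / p : ℕ) : R)
  else 0

/-- `η` is the coefficient sequence of some `δ = ∑_{j=0}^{k-1-l} η_j (x-1)^j`, with coefficients in
the Teichmüller set and `η_0 ≠ 0` (so that `l < k`). Coefficients outside the range are zero. -/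
structure IsDeltaCoeff (p m k l : ℕ) {R : Type*} [CommRing R] (η : ℕ → R) : Prop where
  lt : l < k
  mem : ∀ j, η j ∈ teichmullerSet p m R
  zero_ne : η 0 ≠ 0
  eq_zero : ∀ j, k - l ≤ j → η j = 0

/-- `δ = ∑_{j=0}^{k-1-l} η_j (x-1)^j`. -/
noncomputable def deltaPoly {R : Type*} [CommRing R] (N k l : ℕ) (η : ℕ → R) :
    CyclicAmbient R N :=
  ∑ j ∈ Finset.range (k - l), AdjoinRoot.of (X ^ N - 1 : R[X]) (η j) * xSubOne R N ^ j

/-- `z = min ({j | γ_j ≠ η_j} ∪ {p^s})`. -/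
noncomputable def firstDiff (p m s : ℕ) {R : Type*} [CommRing R] (η : ℕ → R) : ℕ :=
  sInf ({j | gammaCoeff p m s R j ≠ η j} ∪ {p ^ s})

section Helpers

variable {p m : ℕ} {R : Type*} [CommRing R] [IsLocalRing R]

theorem IsGaloisRing.p_sq (h : IsGaloisRing p 2 m R) : (p : R) * p = 0 := by
  have := h.charP
  have h2 := CharP.cast_eq_zero R (p ^ 2)
  rw [← h2]; push_cast; ring

theorem IsGaloisRing.card_residueField (h : IsGaloisRing p 2 m R) (hp : p.Prime) :
    Nat.card (IsLocalRing.ResidueField R) = p ^ m := by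
  have hch := h.charP
  have hp0 : (p : R) ≠ 0 := by
    intro h0
    have := (CharP.cast_eq_zero_iff R (p ^ 2) p).1 h0
    have := Nat.le_of_dvd hp.pos this
    nlinarith [hp.two_le]
  let f : R →ₗ[R] R := LinearMap.mulLeft R (p : R)
  have hker : LinearMap.ker f = IsLocalRing.maximalIdeal R := by
    ext r
    simp only [LinearMap.mem_ker, f, LinearMap.mulLeft_apply]
    constructor
    · intro hr
      rw [IsLocalRing.mem_maximalIdeal]
      intro hu
      exact hp0 ((hu.mul_left_eq_zero).1 hr)
    · intro hr
      rw [h.maximalIdeal_eq, Ideal.mem_span_singleton'] at hr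
      obtain ⟨a, rfl⟩ := hr
      rw [mul_left_comm, h.p_sq, mul_zero]
  have hran : LinearMap.range f = IsLocalRing.maximalIdeal R := by
    ext r
    rw [h.maximalIdeal_eq, Ideal.mem_span_singleton']
    simp only [LinearMap.mem_range, f, LinearMap.mulLeft_apply, mul_comm]
  have e := f.quotKerEquivRange
  have h1 : Nat.card (R ⧸ IsLocalRing.maximalIdeal R) = Nat.card (IsLocalRing.maximalIdeal R) := by
    rw [hker, hran] at e
    exact Nat.card_congr e.toEquiv
  have h2 := Submodule.card_eq_card_quotient_mul_card (IsLocalRing.maximalIdeal R)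
  rw [h.card_eq, ← h1] at h2
  have h3 : (p ^ m) ^ 2 = (Nat.card (R ⧸ IsLocalRing.maximalIdeal R)) ^ 2 := by
    rw [sq (Nat.card _)]
    rw [← pow_mul, mul_comm]
    exact h2
  exact (Nat.pow_left_injective (n := 2) (by norm_num) h3).symm

theorem residue_teichmullerRep (h : IsGaloisRing p 2 m R) (hp : p.Prime) (r : R) :
    IsLocalRing.residue R (teichmullerRep p m r) = IsLocalRing.residue R r := by
  have hc := h.card_residueField hp
  have : Finite (IsLocalRing.ResidueField R) :=
    Nat.finite_of_card_ne_zero (by rw [hc]; exact (pow_pos hp.pos m).ne')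
  have := Fintype.ofFinite (IsLocalRing.ResidueField R)
  rw [teichmullerRep, map_pow, ← hc, Nat.card_eq_fintype_card, FiniteField.pow_card]

theorem teichmullerRep_mem (h : IsGaloisRing p 2 m R) (hp : p.Prime) (r : R) :
    teichmullerRep p m r ∈ teichmullerSet p m R := by
  have hc := h.card_residueField hp
  have hfin : Finite (IsLocalRing.ResidueField R) :=
    Nat.finite_of_card_ne_zero (by rw [hc]; exact (pow_pos hp.pos m).ne')
  have := Fintype.ofFinite (IsLocalRing.ResidueField R)
  have hm : m ≠ 0 := by
    rintro rfl
    have h1 := Finite.one_lt_card (α := IsLocalRing.ResidueField R)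
    rw [hc, pow_zero] at h1
    exact absurd h1 (lt_irrefl 1)
  have h2 : 2 ≤ p ^ m := hp.two_le.trans (Nat.le_self_pow hm p)
  have hpq : (p : R) * ((p ^ m : ℕ) : R) = 0 := by
    obtain ⟨n, rfl⟩ := Nat.exists_eq_succ_of_ne_zero hm
    push_cast
    rw [pow_succ', ← mul_assoc, h.p_sq, zero_mul]
  by_cases hr : IsUnit r
  · right
    have h1 : r ^ (p ^ m - 1) - 1 ∈ IsLocalRing.maximalIdeal R := by
      rw [← IsLocalRing.residue_eq_zero_iff, map_sub, map_pow, map_one, sub_eq_zero, ← hc,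
        Nat.card_eq_fintype_card]
      exact FiniteField.pow_card_sub_one_eq_one _ (hr.map (IsLocalRing.residue R)).ne_zero
    rw [h.maximalIdeal_eq, Ideal.mem_span_singleton'] at h1
    obtain ⟨a, ha⟩ := h1
    have h3 : r ^ (p ^ m - 1) = 1 + a * p := by rw [ha]; ring
    rw [teichmullerRep, pow_right_comm, h3]
    obtain ⟨k, hk⟩ := Nat.exists_eq_add_of_le h2
    have key : ∀ n : ℕ, (1 + a * (p : R)) ^ n = 1 + n * (a * p) := by
      intro n
      induction n with
      | zero => simp
      | succ n ih =>
        rw [pow_succ, ih]; push_cast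
        linear_combination (n * a ^ 2 : R) * h.p_sq
    rw [key]
    linear_combination a * hpq
  · left
    have h1 : r ∈ IsLocalRing.maximalIdeal R := hr
    rw [h.maximalIdeal_eq, Ideal.mem_span_singleton'] at h1
    obtain ⟨a, rfl⟩ := h1
    rw [teichmullerRep]
    refine pow_eq_zero_of_le h2 ?_
    linear_combination a ^ 2 * h.p_sq

end Helpers

/-! Reduction modulo `p` kills exactly the multiples of `p`, which are also the annihilator of `p`,
and this passes from `R` to `R[x] / ⟨x^N - 1⟩`. An ideal is therefore recovered from its two torsion
ideals, which live over the residue field, where the ideals are the powers of `u = x - 1`. The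
relation `u^(p^s) = -p u^(p^(s-1)) Γ` with `Γ` a unit modulo `p` computes the degree `T_1`
of `⟨u^k + p a, p u^n⟩`: multiplying by `u^(p^s - k)` leaves `p (u^(p^s - k) a - u^(p^(s-1)) Γ)`.

Over the residue field, a polynomial of degree less than `p^(t + 1)` divisible by a high power of
`x - 1` is cut into slices along the exponents modulo `p^t`. Each slice has degree less than `p`, so
its weight exceeds its order of vanishing at `1`, and the values at `1` of the slices, cleared of
their common power of `x - 1`, form a polynomial of degree less than `p^t`, on which one recurses. -/

section Weight

variable {R : Type*} [CommRing R]

theorem two_le_card_support_of_X_sub_one_dvd {f : R[X]} (hf : f ≠ 0) (h : X - 1 ∣ f) :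
    2 ≤ f.support.card := by
  by_contra! hlt
  obtain ⟨n, a, rfl⟩ := card_support_le_one_iff_monomial.1 (Nat.le_of_lt_succ hlt)
  rw [← C_1, dvd_iff_isRoot, IsRoot.def, eval_monomial, one_pow, mul_one] at h
  exact hf (by rw [h, monomial_zero_right])

theorem coeff_X_mul_derivative_sub (f : R[X]) (k n : ℕ) :
    (X * derivative f - C (k : R) * f).coeff n = ((n : R) - k) * f.coeff n := by
  cases n with
  | zero => simp
  | succ n =>
    rw [coeff_sub, coeff_X_mul, coeff_derivative, coeff_C_mul]
    push_cast
    ring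

theorem support_X_mul_derivative_sub [IsDomain R] (p : ℕ) [CharP R p] {f : R[X]} {k : ℕ}
    (hf : f.natDegree < p) (hk : k < p) :
    (X * derivative f - C (k : R) * f).support = f.support.erase k := by
  ext n
  rw [Finset.mem_erase, mem_support_iff, mem_support_iff, coeff_X_mul_derivative_sub,
    mul_ne_zero_iff, sub_ne_zero, and_congr_left_iff]
  intro hn
  have hnp : n < p := (le_natDegree_of_ne_zero hn).trans_lt hf
  rw [Ne, CharP.natCast_eq_natCast R p, Nat.ModEq, Nat.mod_eq_of_lt hnp, Nat.mod_eq_of_lt hk]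

theorem succ_le_card_support_of_pow_dvd [IsDomain R] (p : ℕ) [CharP R p] {b : ℕ} {f : R[X]}
    (hf : f ≠ 0) (hdeg : f.natDegree < p) (hdvd : (X - 1) ^ b ∣ f) : b + 1 ≤ f.support.card := by
  induction b generalizing f with
  | zero => exact Finset.card_pos.2 (support_nonempty.2 hf)
  | succ b ih =>
    obtain ⟨k, hk⟩ := support_nonempty.2 hf
    -- Since `deg f < p`, the operator `x d/dx - k` deletes the term of degree `k` and no other.
    have hkp : k < p := (le_natDegree_of_mem_supp k hk).trans_lt hdeg
    have hsupp := support_X_mul_derivative_sub p hdeg hkp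
    set g := X * derivative f - C (k : R) * f
    have hcard : g.support.card + 1 = f.support.card := hsupp ▸ Finset.card_erase_add_one hk
    have htwo : 2 ≤ f.support.card :=
      two_le_card_support_of_X_sub_one_dvd hf ((dvd_pow_self _ b.succ_ne_zero).trans hdvd)
    have hg : g ≠ 0 := support_nonempty.1 (Finset.card_pos.1 (by omega))
    have hgdeg : g.natDegree < p :=
      (natDegree_le_natDegree (degree_mono (hsupp ▸ Finset.erase_subset k f.support))).trans_lt hdeg
    have hgdvd : (X - 1) ^ b ∣ g :=
      dvd_sub ((pow_sub_one_dvd_derivative_of_pow_dvd hdvd).mul_left X)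
        (((pow_dvd_pow _ b.le_succ).trans hdvd).mul_left _)
    have := ih hg hgdeg hgdvd
    omega

/-- The slice of `f` on the exponents congruent to `c` modulo `q` (for `c < q`), with the exponent
`a * q + c` renumbered to `a`. -/
noncomputable def residueSlice (q c : ℕ) (f : R[X]) : R[X] :=
  ∑ a ∈ Finset.range (f.natDegree + 1), monomial a (f.coeff (a * q + c))

variable {q : ℕ}

theorem coeff_residueSlice (hq : 0 < q) (c : ℕ) (f : R[X]) (a : ℕ) :
    (residueSlice q c f).coeff a = f.coeff (a * q + c) := by
  simp only [residueSlice, finsetSum_coeff, coeff_monomial]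
  rw [Finset.sum_ite_eq', ite_eq_left_iff, Finset.mem_range, not_lt]
  intro ha
  exact (coeff_eq_zero_of_natDegree_lt (by nlinarith)).symm

theorem degree_residueSlice_lt (hq : 0 < q) {n : ℕ} (c : ℕ) {f : R[X]}
    (hf : f.degree < (n * q : ℕ)) :
    (residueSlice q c f).degree < n := by
  rw [degree_lt_iff_coeff_zero] at hf ⊢
  intro a ha
  rw [coeff_residueSlice hq]
  exact hf _ ((Nat.mul_le_mul_right q ha).trans (Nat.le_add_right _ _))

theorem sum_X_pow_mul_expand_residueSlice (hq : 0 < q) (f : R[X]) :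
    ∑ c ∈ Finset.range q, X ^ c * expand R q (residueSlice q c f) = f := by
  ext n
  rw [finsetSum_coeff, Finset.sum_eq_single_of_mem _ (Finset.mem_range.2 (Nat.mod_lt n hq))]
  · rw [coeff_X_pow_mul', if_pos (Nat.mod_le n q), coeff_expand hq, if_pos (Nat.dvd_sub_mod n),
      coeff_residueSlice hq, Nat.div_mul_cancel (Nat.dvd_sub_mod n),
      Nat.sub_add_cancel (Nat.mod_le n q)]
  · intro c hc hne
    rw [coeff_X_pow_mul', ite_eq_right_iff]
    intro hcn
    rw [coeff_expand hq, if_neg]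
    intro hdvd
    have hmod : c % q = n % q := (Nat.modEq_iff_dvd' hcn).2 hdvd
    exact hne (hmod ▸ (Nat.mod_eq_of_lt (Finset.mem_range.1 hc)).symm)

theorem exists_residueSlice_ne_zero (hq : 0 < q) {f : R[X]} (hf : f ≠ 0) :
    ∃ c ∈ Finset.range q, residueSlice q c f ≠ 0 := by
  by_contra! hall
  refine hf ?_
  rw [← sum_X_pow_mul_expand_residueSlice hq f]
  exact Finset.sum_eq_zero fun c hc => by rw [hall c hc, map_zero, mul_zero]

theorem card_support_eq_sum_residueSlice (hq : 0 < q) (f : R[X]) :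
    f.support.card = ∑ c ∈ Finset.range q, (residueSlice q c f).support.card := by
  rw [Finset.card_eq_sum_card_fiberwise (f := (· % q)) (t := Finset.range q)
    fun n _ => Finset.mem_coe.2 (Finset.mem_range.2 (Nat.mod_lt n hq))]
  refine Finset.sum_congr rfl fun c hc => (Finset.card_bij (fun a _ => a * q + c) ?_ ?_ ?_).symm
  · intro a ha
    rw [mem_support_iff, coeff_residueSlice hq] at ha
    rw [Finset.mem_filter, mem_support_iff, Nat.mul_add_mod',
      Nat.mod_eq_of_lt (Finset.mem_range.1 hc)]
    exact ⟨ha, rfl⟩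
  · intro a _ b _ h
    exact Nat.eq_of_mul_eq_mul_right hq (Nat.add_right_cancel h)
  · intro n hn
    obtain ⟨hn, rfl⟩ := Finset.mem_filter.1 hn
    have hdiv : n / q * q + n % q = n := Nat.div_add_mod' n q
    exact ⟨n / q, by rwa [mem_support_iff, coeff_residueSlice hq, hdiv, ← mem_support_iff], hdiv⟩

theorem card_support_expand_le (hq : 0 < q) (g : R[X]) :
    (expand R q g).support.card ≤ g.support.card := by
  refine (Finset.card_le_card fun n hn => ?_).trans
    (Finset.card_image_le (s := g.support) (f := (· * q)))
  rw [mem_support_iff, coeff_expand hq, ite_ne_right_iff] at hn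
  exact Finset.mem_image.2 ⟨n / q, mem_support_iff.2 hn.2, Nat.div_mul_cancel hn.1⟩

theorem X_pow_sub_one_dvd_sum_expand_sub (s : Finset ℕ) (g : ℕ → R[X]) :
    X ^ q - 1 ∣ ∑ c ∈ s, X ^ c * expand R q (g c) - ∑ c ∈ s, monomial c ((g c).eval 1) := by
  rw [← Finset.sum_sub_distrib]
  refine Finset.dvd_sum fun c _ => ?_
  have hdvd := map_dvd (expand R q) (X_sub_C_dvd_sub_C_eval (a := 1) (p := g c))
  rw [map_sub, map_sub, expand_X, expand_C, expand_C, C_1] at hdvd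
  rw [← C_mul_X_pow_eq_monomial, mul_comm (C _), ← mul_sub]
  exact hdvd.mul_left _

theorem coeff_sum_monomial (s : Finset ℕ) (a : ℕ → R) (n : ℕ) :
    (∑ c ∈ s, monomial c (a c)).coeff n = if n ∈ s then a n else 0 := by
  simp only [finsetSum_coeff, coeff_monomial]
  exact Finset.sum_ite_eq' s n a

theorem X_sub_one_pow_char_pow (p : ℕ) [Fact p.Prime] [CharP R p] (t : ℕ) :
    (X - 1 : R[X]) ^ p ^ t = X ^ p ^ t - 1 := by
  rw [sub_pow_char_pow, one_pow]

theorem X_sub_one_ne_zero [Nontrivial R] : (X - 1 : R[X]) ≠ 0 := by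
  rw [← C_1]
  exact X_sub_C_ne_zero 1

theorem natDegree_X_sub_one_pow [Nontrivial R] (i : ℕ) : ((X - 1 : R[X]) ^ i).natDegree = i := by
  rw [← C_1, (monic_X_sub_C 1).natDegree_pow, natDegree_X_sub_C, mul_one]

theorem eq_pow_mul_sum_expand (hq : 0 < q) {f : R[X]} {b : ℕ} {g : ℕ → R[X]}
    (hg : ∀ c ∈ Finset.range q, residueSlice q c f = (X - 1) ^ b * g c) :
    f = (X ^ q - 1) ^ b * ∑ c ∈ Finset.range q, X ^ c * expand R q (g c) := by
  nth_rw 1 [← sum_X_pow_mul_expand_residueSlice hq f]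
  rw [Finset.mul_sum]
  refine Finset.sum_congr rfl fun c hc => ?_
  rw [hg c hc, map_mul, map_pow, map_sub, expand_X, map_one]
  ring

theorem card_support_X_sub_one_pow_le [Nontrivial R] (p : ℕ) [Fact p.Prime] [CharP R p]
    (t n : ℕ) :
    ((X - 1 : R[X]) ^ (p ^ t * n)).support.card ≤ n + 1 := by
  have hexpand : (X - 1 : R[X]) ^ (p ^ t * n) = expand R (p ^ t) ((X - 1) ^ n) := by
    rw [pow_mul, X_sub_one_pow_char_pow, map_pow, map_sub, expand_X, map_one]
  rw [hexpand]
  refine (card_support_expand_le (pow_pos (Fact.out : p.Prime).pos t) _).trans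
    ((card_supp_le_succ_natDegree _).trans_eq ?_)
  rw [natDegree_X_sub_one_pow]

theorem card_support_X_sub_one_pow_pred_le [Nontrivial R] (p : ℕ) [Fact p.Prime] [CharP R p]
    (t k n : ℕ) :
    ((X - 1 : R[X]) ^ (p ^ (t + 1) * (p ^ k - 1) + p ^ t * n)).support.card ≤
      (n + 1) * p ^ k := by
  rw [pow_add, mul_comm (n + 1)]
  refine card_support_mul_le.trans (Nat.mul_le_mul ?_ (card_support_X_sub_one_pow_le p t n))
  refine (card_support_X_sub_one_pow_le p (t + 1) _).trans_eq ?_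
  rw [Nat.sub_add_cancel (pow_pos (Fact.out : p.Prime).pos k)]

theorem exists_common_X_sub_C_pow_factor {ι : Type*} (a : R) {s : Finset ι} {v : ι → R[X]}
    (hv : ∃ c ∈ s, v c ≠ 0) :
    ∃ (b : ℕ) (g : ι → R[X]),
      (∀ c ∈ s, v c = (X - C a) ^ b * g c) ∧ ∃ c ∈ s, (g c).eval a ≠ 0 := by
  classical
  obtain ⟨c₀, hc₀, hmin⟩ := (s.filter (v · ≠ 0)).exists_min_image
    (fun c => (v c).rootMultiplicity a) (Finset.filter_nonempty_iff.2 hv)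
  obtain ⟨hc₀s, hc₀v⟩ := Finset.mem_filter.1 hc₀
  obtain ⟨b, hb⟩ : ∃ b, b = (v c₀).rootMultiplicity a := ⟨_, rfl⟩
  have hdvd : ∀ c ∈ s, (X - C a) ^ b ∣ v c := by
    intro c hc
    by_cases h0 : v c = 0
    · exact h0 ▸ dvd_zero _
    · exact (le_rootMultiplicity_iff h0).1 (hb ▸ hmin c (Finset.mem_filter.2 ⟨hc, h0⟩))
  choose! g hg using hdvd
  refine ⟨b, g, hg, c₀, hc₀s, fun hroot => ?_⟩
  have hdvd' : (X - C a) ^ (b + 1) ∣ v c₀ := by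
    rw [pow_succ, hg c₀ hc₀s]
    exact mul_dvd_mul_left _ (dvd_iff_isRoot.2 hroot)
  exact Nat.not_succ_le_self b (((le_rootMultiplicity_iff hc₀v).2 hdvd').trans_eq hb.symm)

variable [IsDomain R]

theorem le_natDegree_of_X_sub_one_pow_dvd {f : R[X]} (hf : f ≠ 0) {i : ℕ}
    (h : (X - 1) ^ i ∣ f) : i ≤ f.natDegree := by
  rw [← natDegree_X_sub_one_pow (R := R) i]
  exact natDegree_le_of_dvd h hf

theorem pow_sub_dvd_of_pow_dvd_pow_mul {u v : R} (hu : u ≠ 0) {i a : ℕ} (h : u ^ i ∣ u ^ a * v) :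
    u ^ (i - a) ∣ v := by
  rcases le_total i a with hia | hai
  · rw [Nat.sub_eq_zero_of_le hia, pow_zero]
    exact one_dvd v
  · rwa [← Nat.add_sub_cancel' hai, pow_add, mul_dvd_mul_iff_left (pow_ne_zero a hu)] at h

theorem succ_mul_card_support_sum_monomial_le (hq : 0 < q) (p : ℕ) [CharP R p] {f : R[X]} {b : ℕ}
    {g : ℕ → R[X]} (hf : f.degree < (p * q : ℕ))
    (hg : ∀ c ∈ Finset.range q, residueSlice q c f = (X - 1) ^ b * g c) :
    (b + 1) * (∑ c ∈ Finset.range q, monomial c ((g c).eval 1)).support.card ≤ f.support.card := by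
  have hmem : ∀ c ∈ (∑ c ∈ Finset.range q, monomial c ((g c).eval 1)).support,
      c ∈ Finset.range q ∧ (g c).eval 1 ≠ 0 := fun c hc => by
    rwa [mem_support_iff, coeff_sum_monomial, ite_ne_right_iff] at hc
  have hslice : ∀ c ∈ (∑ c ∈ Finset.range q, monomial c ((g c).eval 1)).support,
      b + 1 ≤ (residueSlice q c f).support.card := by
    intro c hc
    obtain ⟨hcq, hgc⟩ := hmem c hc
    have h0 : residueSlice q c f ≠ 0 := by
      rw [hg c hcq]
      refine mul_ne_zero (pow_ne_zero _ X_sub_one_ne_zero) ?_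
      rintro h0
      exact hgc (h0 ▸ eval_zero)
    exact succ_le_card_support_of_pow_dvd p h0
      ((natDegree_lt_iff_degree_lt h0).2 (degree_residueSlice_lt hq c hf)) ⟨_, hg c hcq⟩
  rw [card_support_eq_sum_residueSlice hq f, mul_comm, ← smul_eq_mul]
  exact (Finset.card_nsmul_le_sum _ _ _ hslice).trans
    (Finset.sum_le_sum_of_subset fun c hc => (hmem c hc).1)

variable {p : ℕ} [Fact p.Prime] [CharP R p] {t : ℕ}

-- Writing the slices of `f` as `(x - 1)^b g_c` with `b` maximal, `f = (x - 1)^(bq) ∑ x^c g_c(x^q)`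
-- for `q = p^t`, and `h = ∑ g_c(1) x^c` is congruent to the cofactor modulo `(x - 1)^q = x^q - 1`.
theorem exists_reduced_weight {i : ℕ} {f : R[X]} (hf : f ≠ 0)
    (hdeg : f.degree < (p ^ (t + 1) : ℕ)) (hdvd : (X - 1) ^ i ∣ f) :
    ∃ (b : ℕ) (h : R[X]), b < p ∧ i < (b + 1) * p ^ t ∧ h ≠ 0 ∧ h.degree < (p ^ t : ℕ) ∧
      (X - 1) ^ (i - b * p ^ t) ∣ h ∧ (b + 1) * h.support.card ≤ f.support.card := by
  have hq : 0 < p ^ t := pow_pos (Fact.out : p.Prime).pos t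
  rw [pow_succ'] at hdeg
  obtain ⟨b, g, hg, c, hc, hgc⟩ :=
    exists_common_X_sub_C_pow_factor 1 (exists_residueSlice_ne_zero hq hf)
  rw [C_1] at hg
  have hfac := eq_pow_mul_sum_expand hq hg
  have hcongr := X_pow_sub_one_dvd_sum_expand_sub (q := p ^ t) (Finset.range (p ^ t)) g
  rw [← X_sub_one_pow_char_pow p t] at hfac hcongr
  rw [← pow_mul, mul_comm _ b] at hfac
  set G := ∑ c ∈ Finset.range (p ^ t), X ^ c * expand R (p ^ t) (g c)
  set h := ∑ c ∈ Finset.range (p ^ t), monomial c ((g c).eval 1)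
  have hcoeff := coeff_sum_monomial (Finset.range (p ^ t)) fun c => (g c).eval 1
  have h0 : h ≠ 0 := support_nonempty.1 ⟨c, by rwa [mem_support_iff, hcoeff, if_pos hc]⟩
  have hhdeg : h.degree < (p ^ t : ℕ) := degree_lt_iff_coeff_zero _ _ |>.2 fun n hn => by
    rw [hcoeff, if_neg (by simpa using hn)]
  have hhnat : h.natDegree < p ^ t := (natDegree_lt_iff_degree_lt h0).2 hhdeg
  have hfnat : f.natDegree < p * p ^ t := (natDegree_lt_iff_degree_lt hf).2 hdeg
  have hb : b * p ^ t ≤ f.natDegree := le_natDegree_of_X_sub_one_pow_dvd hf ⟨G, hfac⟩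
  have hG : (X - 1) ^ (i - b * p ^ t) ∣ G :=
    pow_sub_dvd_of_pow_dvd_pow_mul X_sub_one_ne_zero (hfac ▸ hdvd)
  have hmin : (X - 1) ^ min (i - b * p ^ t) (p ^ t) ∣ h :=
    (dvd_iff_dvd_of_dvd_sub ((pow_dvd_pow _ (min_le_right _ _)).trans hcongr)).1
      ((pow_dvd_pow _ (min_le_left _ _)).trans hG)
  have hlt : i - b * p ^ t < p ^ t := by
    have := le_natDegree_of_X_sub_one_pow_dvd h0 hmin
    omega
  rw [min_eq_left hlt.le] at hmin
  refine ⟨b, h, Nat.lt_of_mul_lt_mul_right (hb.trans_lt hfnat), ?_, h0, hhdeg, hmin,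
    succ_mul_card_support_sum_monomial_le hq p hdeg hg⟩
  rw [Nat.succ_mul]
  omega

theorem add_two_le_card_support {b i : ℕ} {f : R[X]} (hf : f ≠ 0)
    (hdeg : f.degree < (p ^ (t + 1) : ℕ)) (hdvd : (X - 1) ^ i ∣ f) (hi : b * p ^ t + 1 ≤ i) :
    b + 2 ≤ f.support.card := by
  obtain ⟨b', h, -, hib, h0, -, hd, hw⟩ := exists_reduced_weight hf hdeg hdvd
  have hbb : b < b' + 1 := Nat.lt_of_mul_lt_mul_right (by omega : b * p ^ t < (b' + 1) * p ^ t)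
  rcases (Nat.le_of_lt_succ hbb).eq_or_lt with rfl | hlt
  · have htwo : 2 ≤ h.support.card :=
      two_le_card_support_of_X_sub_one_dvd h0 ((dvd_pow_self _ (by omega)).trans hd)
    nlinarith
  · have hone : 1 ≤ h.support.card := Finset.card_pos.2 (support_nonempty.2 h0)
    nlinarith

theorem exists_reduced_weight_iterate {j : ℕ} (k : ℕ) {f : R[X]} (hf : f ≠ 0)
    (hdeg : f.degree < (p ^ (t + k) : ℕ)) (hdvd : (X - 1) ^ (p ^ (t + k) - p ^ t + j) ∣ f) :
    ∃ h : R[X], h ≠ 0 ∧ h.degree < (p ^ t : ℕ) ∧ (X - 1) ^ j ∣ h ∧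
      p ^ k * h.support.card ≤ f.support.card := by
  have hp : p.Prime := Fact.out
  induction k generalizing f with
  | zero =>
    rw [add_zero] at hdeg hdvd
    exact ⟨f, hf, hdeg, by simpa using hdvd, by rw [pow_zero, one_mul]⟩
  | succ k ih =>
    obtain ⟨b, h, hb, hi, h0, hhdeg, hhdvd, hw⟩ := exists_reduced_weight (t := t + k) hf hdeg hdvd
    have htk : p ^ t ≤ p ^ (t + k) := Nat.pow_le_pow_right hp.pos (Nat.le_add_right t k)
    have hsucc : p ^ (t + (k + 1)) = (p - 1) * p ^ (t + k) + p ^ (t + k) := by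
      rw [← Nat.succ_mul, Nat.succ_eq_add_one, Nat.sub_add_cancel hp.one_le, ← add_assoc, pow_succ']
    have hpb : p - 1 < b + 1 := Nat.lt_of_mul_lt_mul_right
      (by omega : (p - 1) * p ^ (t + k) < (b + 1) * p ^ (t + k))
    obtain rfl : b = p - 1 := by omega
    obtain ⟨h', h0', hdeg', hdvd', hw'⟩ := ih h0 hhdeg ((pow_dvd_pow _ (by omega)).trans hhdvd)
    refine ⟨h', h0', hdeg', hdvd', ?_⟩
    rw [Nat.sub_add_cancel hp.one_le] at hw
    rw [pow_succ', mul_assoc]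
    exact (Nat.mul_le_mul_left p hw').trans hw

theorem mul_le_card_support {k b i : ℕ} {f : R[X]} (hf : f ≠ 0)
    (hdeg : f.degree < (p ^ (t + 1 + k) : ℕ)) (hdvd : (X - 1) ^ i ∣ f)
    (hi : p ^ (t + 1 + k) - p ^ (t + 1) + b * p ^ t + 1 ≤ i) :
    (b + 2) * p ^ k ≤ f.support.card := by
  obtain ⟨h, h0, hhdeg, hhdvd, hw⟩ := exists_reduced_weight_iterate (j := b * p ^ t + 1) k hf hdeg
    ((pow_dvd_pow _ (by omega)).trans hdvd)
  rw [mul_comm]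
  exact (Nat.mul_le_mul_left _ (add_two_le_card_support h0 hhdeg hhdvd le_rfl)).trans hw

end Weight

section Reduction

variable {A B : Type*} [CommRing A] [CommRing B]

/-- The homomorphism `φ` models reduction modulo an element `π` of square zero, as for `π = p` in
characteristic `p^2`: the multiples of `π` are both the kernel of `φ` and the annihilator of `π`. -/
structure IsSquareZeroReduction (π : A) (φ : A →+* B) : Prop where
  surjective : Function.Surjective φ
  map_eq_zero_iff_dvd : ∀ a, φ a = 0 ↔ π ∣ a
  mul_eq_zero_iff : ∀ a, π * a = 0 ↔ φ a = 0

namespace IsSquareZeroReduction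

variable {π : A} {φ : A →+* B}

theorem map_self (h : IsSquareZeroReduction π φ) : φ π = 0 :=
  (h.map_eq_zero_iff_dvd π).2 dvd_rfl

theorem mul_self (h : IsSquareZeroReduction π φ) : π * π = 0 :=
  (h.mul_eq_zero_iff π).2 h.map_self

theorem mul_eq_mul_iff (h : IsSquareZeroReduction π φ) {a b : A} :
    π * a = π * b ↔ φ a = φ b := by
  rw [← sub_eq_zero, ← mul_sub, h.mul_eq_zero_iff, map_sub, sub_eq_zero]

theorem exists_eq_add_mul (h : IsSquareZeroReduction π φ) {a b : A} (hab : φ a = φ b) :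
    ∃ c, a = b + π * c := by
  obtain ⟨c, hc⟩ := (h.map_eq_zero_iff_dvd (a - b)).1 (by rw [map_sub, hab, sub_self])
  exact ⟨c, eq_add_of_sub_eq' hc⟩

theorem polynomial (h : IsSquareZeroReduction π φ) :
    IsSquareZeroReduction (C π) (mapRingHom φ) where
  surjective := map_surjective φ h.surjective
  map_eq_zero_iff_dvd f := by
    simp only [C_dvd_iff_dvd_coeff, ← h.map_eq_zero_iff_dvd, Polynomial.ext_iff, coe_mapRingHom,
      coeff_map, coeff_zero]
  mul_eq_zero_iff f := by
    simp only [Polynomial.ext_iff, coeff_C_mul, h.mul_eq_zero_iff, coe_mapRingHom, coeff_map,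
      coeff_zero]

theorem support_C_mul (h : IsSquareZeroReduction π φ) (f : A[X]) :
    (C π * f).support = (f.map φ).support := by
  ext n
  rw [mem_support_iff, mem_support_iff, coeff_C_mul, coeff_map, Ne, Ne, h.mul_eq_zero_iff]

end IsSquareZeroReduction

theorem adjoinRootMap_mk (φ : A →+* B) {f : A[X]} {g : B[X]} (hg : g ∣ f.map φ) (a : A[X]) :
    AdjoinRoot.map φ f g hg (AdjoinRoot.mk f a) = AdjoinRoot.mk g (a.map φ) := by
  rw [AdjoinRoot.map, AdjoinRoot.lift_mk, ← AdjoinRoot.aeval_eq, aeval_def, eval₂_map,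
    AdjoinRoot.algebraMap_eq]

theorem adjoinRootMap_surjective {φ : A →+* B} (hφ : Function.Surjective φ) {f : A[X]} {g : B[X]}
    (hg : g ∣ f.map φ) : Function.Surjective (AdjoinRoot.map φ f g hg) := by
  intro b
  obtain ⟨b, rfl⟩ := AdjoinRoot.mk_surjective b
  obtain ⟨a, rfl⟩ := Polynomial.map_surjective φ hφ b
  exact ⟨AdjoinRoot.mk f a, adjoinRootMap_mk φ hg a⟩

theorem IsSquareZeroReduction.adjoinRoot {π : A} {φ : A →+* B} (h : IsSquareZeroReduction π φ)
    {f : A[X]} {g : B[X]} (hfg : f.map φ = g) (hg : g ∈ nonZeroDivisors B[X]) :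
    IsSquareZeroReduction (AdjoinRoot.of f π) (AdjoinRoot.map φ f g hfg.symm.dvd) := by
  have hpoly := h.polynomial
  have hself : AdjoinRoot.of f π * AdjoinRoot.of f π = 0 := by rw [← map_mul, h.mul_self, map_zero]
  have hdvd : ∀ a, AdjoinRoot.map φ f g hfg.symm.dvd a = 0 → AdjoinRoot.of f π ∣ a := by
    intro a ha
    obtain ⟨a, rfl⟩ := AdjoinRoot.mk_surjective a
    rw [adjoinRootMap_mk, AdjoinRoot.mk_eq_zero] at ha
    obtain ⟨b, hb⟩ := ha
    obtain ⟨b, rfl⟩ := hpoly.surjective b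
    obtain ⟨c, rfl⟩ := hpoly.exists_eq_add_mul (a := a) (b := f * b) (by
      rw [map_mul, coe_mapRingHom, hb, hfg, coe_mapRingHom])
    rw [map_add, map_mul, map_mul, AdjoinRoot.mk_self, zero_mul, zero_add, AdjoinRoot.mk_C]
    exact dvd_mul_right _ _
  refine ⟨adjoinRootMap_surjective h.surjective _, fun a => ⟨hdvd a, ?_⟩,
    fun a => ⟨fun ha => ?_, fun ha => ?_⟩⟩
  · rintro ⟨b, rfl⟩
    rw [map_mul, AdjoinRoot.map_of, h.map_self, map_zero, zero_mul]
  · obtain ⟨a, rfl⟩ := AdjoinRoot.mk_surjective a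
    rw [← AdjoinRoot.mk_C, ← map_mul, AdjoinRoot.mk_eq_zero] at ha
    obtain ⟨b, hb⟩ := ha
    -- Reducing `π a = f b` gives `0 = g φ(b)`, so `b = π c` and `π (a - f c) = 0`.
    have hb0 : mapRingHom φ b = 0 := by
      refine (mul_left_mem_nonZeroDivisors_eq_zero_iff hg).1 ?_
      have hφ := congrArg (mapRingHom φ) hb
      rwa [map_mul, map_mul, hpoly.map_self, zero_mul, coe_mapRingHom, hfg, eq_comm] at hφ
    obtain ⟨c, rfl⟩ := (hpoly.map_eq_zero_iff_dvd b).1 hb0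
    have hac : mapRingHom φ a = mapRingHom φ (f * c) := hpoly.mul_eq_mul_iff.1 (by rw [hb]; ring)
    rw [adjoinRootMap_mk, ← coe_mapRingHom, hac, map_mul, map_mul, coe_mapRingHom, hfg,
      AdjoinRoot.mk_self, zero_mul]
  · obtain ⟨b, rfl⟩ := hdvd a ha
    rw [← mul_assoc, hself, zero_mul]

/-- The torsion ideal `{φ v | x v ∈ C}`, for surjective `φ`; the codes `Tor_i` are the cases
`x = p^i`. -/
def torsionIdeal (φ : A →+* B) (x : A) (C : Ideal A) : Ideal B :=
  (C.colon {x}).map φ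

theorem mem_torsionIdeal {φ : A →+* B} (hφ : Function.Surjective φ) {x : A} {C : Ideal A} {w : B} :
    w ∈ torsionIdeal φ x C ↔ ∃ v, x * v ∈ C ∧ φ v = w := by
  simp only [torsionIdeal, Ideal.mem_map_iff_of_surjective φ hφ, Submodule.mem_colon_singleton,
    smul_eq_mul, mul_comm x]

theorem torsionIdeal_one (φ : A →+* B) (C : Ideal A) : torsionIdeal φ 1 C = C.map φ := by
  rw [torsionIdeal, show C.colon {(1 : A)} = C from
    Ideal.ext fun a => by rw [Submodule.mem_colon_singleton, smul_eq_mul, mul_one]]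

theorem torsionIdeal_one_le (φ : A →+* B) (x : A) (C : Ideal A) :
    torsionIdeal φ 1 C ≤ torsionIdeal φ x C := by
  rw [torsionIdeal_one]
  refine Ideal.map_mono fun a ha => ?_
  rw [Submodule.mem_colon_singleton]
  exact C.mul_mem_right x ha

namespace IsSquareZeroReduction

variable {π : A} {φ : A →+* B}

theorem map_span_pair (h : IsSquareZeroReduction π φ) (f g : A) :
    (Ideal.span {f, π * g}).map φ = Ideal.span {φ f} := by
  rw [Ideal.map_span, Set.image_pair, map_mul, h.map_self, zero_mul, Ideal.span_insert,
    Ideal.span_singleton_zero, sup_bot_eq]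

theorem eq_span_pair (h : IsSquareZeroReduction π φ) {C : Ideal A} {f g : A} (hf : f ∈ C)
    (hg : π * g ∈ C) (hmap : C.map φ ≤ Ideal.span {φ f})
    (htor : torsionIdeal φ π C ≤ Ideal.span {φ g}) : C = Ideal.span {f, π * g} := by
  refine le_antisymm (fun c hc => Ideal.mem_span_pair.2 ?_) ?_
  · obtain ⟨a, ha⟩ := Ideal.mem_span_singleton'.1 (hmap (Ideal.mem_map_of_mem φ hc))
    obtain ⟨a, rfl⟩ := h.surjective a
    obtain ⟨v, rfl⟩ := h.exists_eq_add_mul (ha.symm.trans (map_mul φ a f).symm)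
    have hv : π * v ∈ C := (C.add_mem_iff_right (C.mul_mem_left a hf)).1 hc
    obtain ⟨b, hb⟩ := Ideal.mem_span_singleton'.1
      (htor ((mem_torsionIdeal h.surjective).2 ⟨v, hv, rfl⟩))
    obtain ⟨b, rfl⟩ := h.surjective b
    rw [← map_mul, ← h.mul_eq_mul_iff] at hb
    exact ⟨a, b, by rw [mul_left_comm, hb]⟩
  · rw [Ideal.span_le, Set.pair_subset_iff]
    exact ⟨hf, hg⟩

theorem span_pair_mul_eq (h : IsSquareZeroReduction π φ) (f a : A) :
    Ideal.span {f + π * a, π * f} = Ideal.span {f + π * a} := by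
  rw [Ideal.span_insert, sup_eq_left, Ideal.span_singleton_le_span_singleton]
  exact ⟨π, by linear_combination -a * h.mul_self⟩

theorem torsionIdeal_span_pair (h : IsSquareZeroReduction π φ) {f g d e : A}
    (hde : d * f = π * e) (hann : ∀ b, b * φ f = 0 → φ d ∣ b) :
    torsionIdeal φ π (Ideal.span {f, π * g}) = Ideal.span {φ f, φ e, φ g} := by
  have hmem {w} := mem_torsionIdeal h.surjective (x := π) (C := Ideal.span {f, π * g}) (w := w)
  have hfC : f ∈ Ideal.span {f, π * g} := Ideal.subset_span (Set.mem_insert _ _)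
  have hgC : π * g ∈ Ideal.span {f, π * g} := Ideal.subset_span (Set.mem_insert_of_mem _ rfl)
  refine le_antisymm (fun w hw => ?_) (Ideal.span_le.2 ?_)
  · obtain ⟨v, hv, rfl⟩ := hmem.1 hw
    obtain ⟨a, b, hab⟩ := Ideal.mem_span_pair.1 hv
    obtain ⟨c, hc⟩ := hann (φ a) (by
      have hφ := congrArg φ hab
      simpa only [map_add, map_mul, h.map_self, zero_mul, mul_zero, add_zero] using hφ)
    obtain ⟨c, rfl⟩ := h.surjective c
    obtain ⟨y, rfl⟩ := h.exists_eq_add_mul (hc.trans (map_mul φ d c).symm)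
    have hv' : φ v = φ (y * f + (c * e + b * g)) := h.mul_eq_mul_iff.1 (by
      linear_combination -hab + c * hde)
    rw [hv', map_add, map_add, map_mul, map_mul, map_mul]
    exact Submodule.mem_span_triple.2 ⟨φ y, φ c, φ b, add_assoc _ _ _⟩
  · rintro _ (rfl | rfl | rfl)
    · exact hmem.2 ⟨f, Ideal.mul_mem_left _ π hfC, rfl⟩
    · exact hmem.2 ⟨e, hde ▸ Ideal.mul_mem_left _ d hfC, rfl⟩
    · exact hmem.2 ⟨g, hgC, rfl⟩

end IsSquareZeroReduction

end Reduction

section Galois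

open IsLocalRing

variable {p m : ℕ} {R : Type*} [CommRing R] [IsLocalRing R]

theorem IsGaloisRing.natCast_ne_zero (h : IsGaloisRing p 2 m R) (hp : p.Prime) : (p : R) ≠ 0 := by
  have := h.charP
  rw [Ne, CharP.cast_eq_zero_iff R (p ^ 2)]
  exact Nat.not_dvd_of_pos_of_lt hp.pos (lt_self_pow₀ hp.one_lt one_lt_two)

theorem IsGaloisRing.isSquareZeroReduction (h : IsGaloisRing p 2 m R) (hp : p.Prime) :
    IsSquareZeroReduction (p : R) (residue R) := by
  have hdvd : ∀ r, residue R r = 0 ↔ (p : R) ∣ r := fun r => by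
    rw [residue_eq_zero_iff, h.maximalIdeal_eq, Ideal.mem_span_singleton]
  refine ⟨residue_surjective, hdvd, fun r => ⟨fun hr => ?_, fun hr => ?_⟩⟩
  · rw [residue_eq_zero_iff, mem_maximalIdeal]
    exact fun hu => h.natCast_ne_zero hp (hu.mul_left_eq_zero.1 hr)
  · obtain ⟨a, rfl⟩ := (hdvd r).1 hr
    rw [← mul_assoc, h.p_sq, zero_mul]

theorem IsSquareZeroReduction.charP_residueField (h : IsSquareZeroReduction (p : R) (residue R))
    (hp : p.Prime) : CharP (ResidueField R) p :=
  (CharP.charP_iff_prime_eq_zero hp).2 (map_natCast (residue R) p ▸ h.map_self)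

theorem IsSquareZeroReduction.cyclicAmbient (h : IsSquareZeroReduction (p : R) (residue R)) {N : ℕ}
    (hN : N ≠ 0) : IsSquareZeroReduction (p : CyclicAmbient R N) (reduction R N) := by
  rw [← map_natCast (AdjoinRoot.of (X ^ N - 1 : R[X])) p]
  exact h.adjoinRoot (by simp) (monic_X_pow_sub_C 1 hN).mem_nonZeroDivisors

theorem reduction_mk {N : ℕ} (f : R[X]) :
    reduction R N (AdjoinRoot.mk _ f) = AdjoinRoot.mk _ (f.map (residue R)) :=
  adjoinRootMap_mk _ _ f

theorem reduction_surjective (N : ℕ) : Function.Surjective (reduction R N) :=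
  adjoinRootMap_surjective residue_surjective _

theorem reduction_xSubOne (N : ℕ) : reduction R N (xSubOne R N) = xSubOne (ResidueField R) N := by
  rw [xSubOne, reduction_mk, Polynomial.map_sub, map_X, Polynomial.map_one, xSubOne]

end Galois

section Expansion

open IsLocalRing

variable {R : Type*} [CommRing R]

/-- The polynomial expression `∑_{j < M} c_j (x - 1)^j` in `R[x] / ⟨x^N - 1⟩`. -/
noncomputable def expansion (N M : ℕ) (c : ℕ → R) : CyclicAmbient R N :=
  ∑ j ∈ Finset.range M, AdjoinRoot.of (X ^ N - 1 : R[X]) (c j) * xSubOne R N ^ j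

theorem expansion_of_forall_eq_zero (N : ℕ) {M : ℕ} {c : ℕ → R} (hc : ∀ j < M, c j = 0) :
    expansion N M c = 0 :=
  Finset.sum_eq_zero fun j hj => by rw [hc j (Finset.mem_range.1 hj), map_zero, zero_mul]

theorem expansion_congr (N : ℕ) {M : ℕ} {c d : ℕ → R} (h : ∀ j < M, c j = d j) :
    expansion N M c = expansion N M d :=
  Finset.sum_congr rfl fun j hj => by rw [h j (Finset.mem_range.1 hj)]

theorem expansion_sub (N M : ℕ) (c d : ℕ → R) :
    expansion N M (c - d) = expansion N M c - expansion N M d := by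
  simp only [expansion, Pi.sub_apply, map_sub, sub_mul, Finset.sum_sub_distrib]

theorem expansion_const_mul (N M : ℕ) (r : R) (c : ℕ → R) :
    expansion N M (fun j => r * c j) = AdjoinRoot.of (X ^ N - 1 : R[X]) r * expansion N M c := by
  simp only [expansion, map_mul, mul_assoc, Finset.mul_sum]

theorem expansion_add (N M L : ℕ) (c : ℕ → R) :
    expansion N (M + L) c =
      expansion N M c + xSubOne R N ^ M * expansion N L fun j => c (M + j) := by
  rw [expansion, Finset.sum_range_add, expansion, expansion, Finset.mul_sum]
  exact congrArg _ (Finset.sum_congr rfl fun j _ => by rw [pow_add, mul_left_comm])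

theorem expansion_succ (N M : ℕ) (c : ℕ → R) :
    expansion N (M + 1) c =
      AdjoinRoot.of (X ^ N - 1 : R[X]) (c 0) + xSubOne R N * expansion N M fun j => c (j + 1) := by
  rw [expansion, Finset.sum_range_succ', add_comm, pow_zero, mul_one, expansion, Finset.mul_sum]
  exact congrArg _ (Finset.sum_congr rfl fun j _ => by rw [pow_succ', mul_left_comm])

theorem expansion_of_le (N : ℕ) {M L : ℕ} (hML : M ≤ L) {c : ℕ → R} (hc : ∀ j, M ≤ j → c j = 0) :
    expansion N L c = expansion N M c := by
  obtain ⟨d, rfl⟩ := Nat.exists_eq_add_of_le hML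
  rw [expansion_add, expansion_of_forall_eq_zero N fun j _ => hc _ (Nat.le_add_right M j), mul_zero,
    add_zero]

theorem expansion_eq_pow_mul (N : ℕ) {z M : ℕ} (hz : z ≤ M) {c : ℕ → R} (hc : ∀ j < z, c j = 0) :
    expansion N M c = xSubOne R N ^ z * expansion N (M - z) fun j => c (z + j) := by
  obtain ⟨d, rfl⟩ := Nat.exists_eq_add_of_le hz
  rw [expansion_add, expansion_of_forall_eq_zero N hc, zero_add, Nat.add_sub_cancel_left]

theorem exists_eq_of_add_xSubOne_mul {N : ℕ} (w : CyclicAmbient R N) :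
    ∃ r v, w = AdjoinRoot.of (X ^ N - 1 : R[X]) r + xSubOne R N * v := by
  obtain ⟨f, rfl⟩ := AdjoinRoot.mk_surjective w
  obtain ⟨g, hg⟩ : X - 1 ∣ f - C (f.eval 1) := by rw [← C_1]; exact X_sub_C_dvd_sub_C_eval
  refine ⟨f.eval 1, AdjoinRoot.mk _ g, ?_⟩
  rw [xSubOne, ← map_mul, ← hg, map_sub, AdjoinRoot.mk_C, add_sub_cancel]

theorem exists_eq_expansion_add {N : ℕ} (M : ℕ) (w : CyclicAmbient R N) :
    ∃ c v, w = expansion N M c + xSubOne R N ^ M * v := by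
  induction M generalizing w with
  | zero => exact ⟨0, w, by rw [expansion, Finset.sum_range_zero, pow_zero, one_mul, zero_add]⟩
  | succ M ih =>
    obtain ⟨r, v, rfl⟩ := exists_eq_of_add_xSubOne_mul w
    obtain ⟨c, v, rfl⟩ := ih v
    refine ⟨fun j => j.casesOn r c, v, ?_⟩
    rw [expansion_succ, pow_succ', mul_add, ← add_assoc, ← mul_assoc]
    rfl

theorem reduction_expansion [IsLocalRing R] (N M : ℕ) (c : ℕ → R) :
    reduction R N (expansion N M c) = expansion N M (residue R ∘ c) := by
  rw [expansion, expansion, map_sum]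
  refine Finset.sum_congr rfl fun j _ => ?_
  rw [map_mul, map_pow, reduction_xSubOne, reduction, AdjoinRoot.map_of, Function.comp_apply]

end Expansion

section ChainRing

theorem span_pow_sup_span_pow {A : Type*} [CommRing A] (u : A) (a b : ℕ) :
    Ideal.span {u ^ a} ⊔ Ideal.span {u ^ b} = Ideal.span {u ^ min a b} := by
  rcases le_total a b with h | h
  · rw [min_eq_left h, sup_eq_left.2 (Ideal.span_singleton_le_span_singleton.2 (pow_dvd_pow u h))]
  · rw [min_eq_right h, sup_eq_right.2 (Ideal.span_singleton_le_span_singleton.2 (pow_dvd_pow u h))]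

theorem span_pow_mul_isUnit_sub {A : Type*} [CommRing A] {u : A} (hu : IsNilpotent u) {a b : ℕ}
    (hab : a ≠ b) {v w : A} (hv : IsUnit v) (hw : IsUnit w) :
    Ideal.span {u ^ a * v - u ^ b * w} = Ideal.span {u ^ min a b} := by
  have hlt : ∀ {a b : ℕ} {v w : A}, IsUnit v → a < b →
      Ideal.span {u ^ a * v - u ^ b * w} = Ideal.span {u ^ a} := by
    intro a b v w hv hlt
    obtain ⟨d, rfl⟩ := Nat.exists_eq_add_of_lt hlt
    rw [show u ^ a * v - u ^ (a + d + 1) * w = u ^ a * (v + u * (-u ^ d * w)) by ring]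
    exact Ideal.span_singleton_mul_right_unit (((Commute.all _ _).isNilpotent_mul_right
      hu).isUnit_add_left_of_commute hv (Commute.all _ _)) _
  rcases hab.lt_or_gt with h | h
  · rw [min_eq_left h.le, hlt hv h]
  · rw [min_eq_right h.le, ← Ideal.span_singleton_neg, neg_sub, hlt hw h]

variable {R : Type*} [CommRing R] {p : ℕ} [Fact p.Prime] [CharP R p] {s : ℕ}

theorem mk_X_sub_one_pow (R : Type*) [CommRing R] (N i : ℕ) :
    AdjoinRoot.mk (X ^ N - 1 : R[X]) ((X - 1) ^ i) = xSubOne R N ^ i :=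
  map_pow _ _ _

theorem mk_mem_span_xSubOne_pow_iff {i : ℕ} (hi : i ≤ p ^ s) {f : R[X]} :
    AdjoinRoot.mk (X ^ p ^ s - 1 : R[X]) f ∈ Ideal.span {xSubOne R (p ^ s) ^ i} ↔
      (X - 1) ^ i ∣ f := by
  rw [Ideal.mem_span_singleton, ← mk_X_sub_one_pow]
  refine ⟨?_, map_dvd _⟩
  rintro ⟨c, hc⟩
  obtain ⟨g, rfl⟩ := AdjoinRoot.mk_surjective c
  rw [← map_mul, AdjoinRoot.mk_eq_mk, ← X_sub_one_pow_char_pow p s] at hc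
  exact (dvd_iff_dvd_of_dvd_sub ((pow_dvd_pow _ hi).trans hc)).2 (dvd_mul_right _ g)

variable [IsDomain R]

theorem xSubOne_pow_eq_zero_iff {i : ℕ} : xSubOne R (p ^ s) ^ i = 0 ↔ p ^ s ≤ i := by
  rw [← mk_X_sub_one_pow, AdjoinRoot.mk_eq_zero, ← X_sub_one_pow_char_pow p s]
  refine ⟨fun h => ?_, pow_dvd_pow _⟩
  have hle := le_natDegree_of_X_sub_one_pow_dvd (pow_ne_zero _ X_sub_one_ne_zero) h
  rwa [natDegree_X_sub_one_pow] at hle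

theorem isNilpotent_xSubOne : IsNilpotent (xSubOne R (p ^ s)) :=
  ⟨p ^ s, xSubOne_pow_eq_zero_iff.2 le_rfl⟩

theorem xSubOne_pow_sub_dvd_of_pow_mul_eq_zero {k : ℕ} {w : CyclicAmbient R (p ^ s)}
    (h : xSubOne R (p ^ s) ^ k * w = 0) : xSubOne R (p ^ s) ^ (p ^ s - k) ∣ w := by
  obtain ⟨f, rfl⟩ := AdjoinRoot.mk_surjective w
  rw [← mk_X_sub_one_pow, ← map_mul, AdjoinRoot.mk_eq_zero, ← X_sub_one_pow_char_pow p s] at h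
  rw [← mk_X_sub_one_pow]
  exact map_dvd _ (pow_sub_dvd_of_pow_dvd_pow_mul X_sub_one_ne_zero h)

theorem le_of_span_xSubOne_pow_le {i j : ℕ} (hi : i ≤ p ^ s)
    (h : Ideal.span {xSubOne R (p ^ s) ^ j} ≤ Ideal.span {xSubOne R (p ^ s) ^ i}) : i ≤ j := by
  have hmem := h (Ideal.mem_span_singleton_self _)
  rw [← mk_X_sub_one_pow R _ j, mk_mem_span_xSubOne_pow_iff hi] at hmem
  have hle := le_natDegree_of_X_sub_one_pow_dvd (pow_ne_zero _ X_sub_one_ne_zero) hmem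
  rwa [natDegree_X_sub_one_pow] at hle

theorem span_xSubOne_pow_injective {i j : ℕ} (hi : i ≤ p ^ s) (hj : j ≤ p ^ s)
    (h : Ideal.span {xSubOne R (p ^ s) ^ i} = Ideal.span {xSubOne R (p ^ s) ^ j}) : i = j :=
  le_antisymm (le_of_span_xSubOne_pow_le hi h.ge) (le_of_span_xSubOne_pow_le hj h.le)

variable {F : Type*} [Field F] [CharP F p]

theorem exists_eq_span_xSubOne_pow (I : Ideal (CyclicAmbient F (p ^ s))) :
    ∃ T ≤ p ^ s, I = Ideal.span {xSubOne F (p ^ s) ^ T} := by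
  set φ := AdjoinRoot.mk (X ^ p ^ s - 1 : F[X])
  obtain ⟨g, hg⟩ := IsPrincipalIdealRing.principal (I.comap φ)
  have hI : I = Ideal.span {φ g} := by
    rw [← Ideal.map_comap_of_surjective φ AdjoinRoot.mk_surjective I, hg,
      Ideal.submodule_span_eq, Ideal.map_span, Set.image_singleton]
  have hdvd : g ∣ (X - 1) ^ p ^ s := by
    rw [X_sub_one_pow_char_pow, ← Ideal.mem_span_singleton, ← Ideal.submodule_span_eq, ← hg,
      Ideal.mem_comap, AdjoinRoot.mk_self]
    exact I.zero_mem
  have hprime : Prime (X - 1 : F[X]) := C_1 (R := F) ▸ prime_X_sub_C 1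
  obtain ⟨T, hT, hass⟩ := (dvd_prime_pow hprime _).1 hdvd
  refine ⟨T, hT, ?_⟩
  rw [hI, ← mk_X_sub_one_pow]
  exact le_antisymm (Ideal.span_singleton_le_span_singleton.2 (map_dvd φ hass.symm.dvd))
    (Ideal.span_singleton_le_span_singleton.2 (map_dvd φ hass.dvd))

theorem isUnit_expansion {M : ℕ} (hM : M ≠ 0) {c : ℕ → F} (hc : c 0 ≠ 0) :
    IsUnit (expansion (p ^ s) M c) := by
  obtain ⟨M, rfl⟩ := Nat.exists_eq_add_one_of_ne_zero hM
  rw [expansion_succ]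
  exact ((Commute.all _ _).isNilpotent_mul_right isNilpotent_xSubOne).isUnit_add_left_of_commute
    (hc.isUnit.map _) (Commute.all _ _)

theorem span_xSubOne_pow_mul_expansion {a z M : ℕ} (hz : z < M) {c : ℕ → F}
    (h0 : ∀ j < z, c j = 0) (hc : c z ≠ 0) :
    Ideal.span {xSubOne F (p ^ s) ^ a * expansion (p ^ s) M c} =
      Ideal.span {xSubOne F (p ^ s) ^ (a + z)} := by
  rw [expansion_eq_pow_mul _ hz.le h0, ← mul_assoc, ← pow_add]
  exact Ideal.span_singleton_mul_right_unit (isUnit_expansion (Nat.sub_ne_zero_of_lt hz) hc) _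

end ChainRing

section ResidueFieldDistance

variable {R : Type*} [CommRing R] [IsDomain R] {p : ℕ} [Fact p.Prime] [CharP R p] {s : ℕ}

theorem hammingDistance_span_eq {i j D : ℕ} (hij : i ≤ j) (hj : j < p ^ s)
    (hup : ((X - 1 : R[X]) ^ j).support.card ≤ D)
    (hlow : ∀ f : R[X], f ≠ 0 → f.degree < (p ^ s : ℕ) → (X - 1) ^ i ∣ f → D ≤ f.support.card) :
    hammingDistance (Ideal.span {xSubOne R (p ^ s) ^ i}) = D := by
  have hmem {f : R[X]} := mk_mem_span_xSubOne_pow_iff (f := f) (hij.trans hj.le)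
  have hne : (X - 1 : R[X]) ^ j ≠ 0 := pow_ne_zero j X_sub_one_ne_zero
  have hdeg : ((X - 1 : R[X]) ^ j).degree < (p ^ s : ℕ) := by
    rw [degree_eq_natDegree hne, natDegree_X_sub_one_pow]
    exact_mod_cast hj
  refine IsLeast.csInf_eq (a := D) ⟨⟨_, hne, hdeg, hmem.2 (pow_dvd_pow _ hij), ?_⟩, ?_⟩
  · exact hup.antisymm (hlow _ hne hdeg (pow_dvd_pow _ hij))
  · rintro _ ⟨f, hf, hd, hm, rfl⟩
    exact hlow f hf hd (hmem.1 hm)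

theorem hammingDistance_span_pow_zero :
    hammingDistance (Ideal.span {xSubOne R (p ^ s) ^ 0}) = 1 := by
  refine hammingDistance_span_eq le_rfl (pow_pos (Fact.out : p.Prime).pos s) ?_ fun f hf _ _ => ?_
  · exact card_support_X_sub_one_pow_le p 0 0
  · exact Finset.card_pos.2 (support_nonempty.2 hf)

theorem hammingDistance_span_eq_add_two {t b i : ℕ} (hb : b + 1 < p) (h1 : b * p ^ t + 1 ≤ i)
    (h2 : i ≤ (b + 1) * p ^ t) :
    hammingDistance (Ideal.span {xSubOne R (p ^ (t + 1)) ^ i}) = b + 2 := by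
  refine hammingDistance_span_eq (j := p ^ t * (b + 1)) (h2.trans_eq (mul_comm _ _)) ?_
    (card_support_X_sub_one_pow_le p t (b + 1))
    fun f hf hd hdv => add_two_le_card_support hf hd hdv h1
  rw [pow_succ]
  exact Nat.mul_lt_mul_of_pos_left hb (pow_pos (Fact.out : p.Prime).pos t)

theorem hammingDistance_span_eq_mul_pow {t k b i : ℕ} (hb : b + 1 < p)
    (h1 : p ^ (t + 1 + k) - p ^ (t + 1) + b * p ^ t + 1 ≤ i)
    (h2 : i ≤ p ^ (t + 1 + k) - p ^ (t + 1) + (b + 1) * p ^ t) :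
    hammingDistance (Ideal.span {xSubOne R (p ^ (t + 1 + k)) ^ i}) = (b + 2) * p ^ k := by
  have hj : p ^ (t + 1) * (p ^ k - 1) + p ^ t * (b + 1) =
      p ^ (t + 1 + k) - p ^ (t + 1) + (b + 1) * p ^ t := by
    rw [Nat.mul_sub, ← pow_add, mul_one, mul_comm (p ^ t)]
  have hlt : (b + 1) * p ^ t < p ^ (t + 1) := by
    rw [pow_succ, mul_comm]
    exact Nat.mul_lt_mul_of_pos_left hb (pow_pos (Fact.out : p.Prime).pos t)
  have hle : p ^ (t + 1) ≤ p ^ (t + 1 + k) :=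
    Nat.pow_le_pow_right (Fact.out : p.Prime).pos (Nat.le_add_right _ _)
  exact hammingDistance_span_eq (h2.trans hj.ge) (by omega)
    (card_support_X_sub_one_pow_pred_le p t k (b + 1))
    fun f hf hd hdv => mul_le_card_support hf hd hdv h1

end ResidueFieldDistance

section Gamma

open IsLocalRing

theorem prime_pow_dvd_choose_prime_pow_iff {p : ℕ} (hp : p.Prime) {n j e : ℕ} (hj : j ≤ p ^ n)
    (hj0 : j ≠ 0) : p ^ e ∣ (p ^ n).choose j ↔ e + j.factorization p ≤ n := by
  have hsum := Nat.factorization_choose_prime_pow_add_factorization hp hj hj0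
  rw [hp.pow_dvd_iff_le_factorization (Nat.choose_pos hj).ne']
  omega

theorem prime_pow_dvd_choose_mul_prime_pow_iff {p a e : ℕ} (hp : p.Prime) (t : ℕ) (ha0 : a ≠ 0)
    (ha : a < p) : p ^ e ∣ (p ^ (t + 1)).choose (a * p ^ t) ↔ e ≤ 1 := by
  have hle : a * p ^ t ≤ p ^ (t + 1) := pow_succ' p t ▸ Nat.mul_le_mul_right _ ha.le
  have hfac : (a * p ^ t).factorization p = t := by
    rw [Nat.factorization_mul ha0 (pow_ne_zero t hp.ne_zero), Finsupp.add_apply,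
      Nat.factorization_eq_zero_of_lt ha, hp.factorization_pow, Finsupp.single_eq_same, zero_add]
  rw [prime_pow_dvd_choose_prime_pow_iff hp hle (mul_ne_zero ha0 (pow_ne_zero t hp.ne_zero)), hfac,
    add_comm t, Nat.add_le_add_iff_right]

theorem gammaCoeff_eq_zero {R : Type*} [CommRing R] {p t j : ℕ} (m : ℕ) (hp : p.Prime)
    (hj : p ^ (t + 1) ≤ p ^ t + j) : gammaCoeff p m (t + 1) R j = 0 := by
  rw [gammaCoeff, Nat.add_sub_cancel]
  refine if_neg fun hc => ?_
  have hdiv : p - 1 ≤ j / p ^ t := by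
    rw [Nat.le_div_iff_mul_le (pow_pos hp.pos t), Nat.sub_mul, one_mul, ← pow_succ']
    omega
  have := hp.two_le
  omega

theorem xSubOne_add_one_pow {R : Type*} [CommRing R] (N : ℕ) : (xSubOne R N + 1) ^ N = 1 := by
  rw [xSubOne, ← map_one (AdjoinRoot.mk (X ^ N - 1 : R[X])), ← map_add, sub_add_cancel, ← map_pow,
    AdjoinRoot.mk_eq_mk]

theorem expansion_choose_eq_one {R : Type*} [CommRing R] (N : ℕ) :
    expansion N (N + 1) (fun j => (N.choose j : R)) = 1 := by
  rw [← xSubOne_add_one_pow N, add_pow, expansion]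
  refine Finset.sum_congr rfl fun j _ => ?_
  rw [map_natCast, one_pow, mul_one, mul_comm]

variable {p m : ℕ} {R : Type*} [CommRing R] [IsLocalRing R]

theorem IsGaloisRing.choose_eq_zero (h : IsGaloisRing p 2 m R) (hp : p.Prime) {t j : ℕ}
    (hj : j ≤ p ^ (t + 1)) (hd : ¬p ^ t ∣ j) : ((p ^ (t + 1)).choose j : R) = 0 := by
  have hj0 : j ≠ 0 := fun hj0 => hd (hj0 ▸ dvd_zero _)
  rw [hp.pow_dvd_iff_le_factorization hj0, not_le] at hd
  have := h.charP
  rw [CharP.cast_eq_zero_iff R (p ^ 2), prime_pow_dvd_choose_prime_pow_iff hp hj hj0]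
  omega

theorem IsGaloisRing.choose_eq_mul_gammaCoeff (h : IsGaloisRing p 2 m R) (hp : p.Prime) {t j : ℕ}
    (hj : p ^ t + j < p ^ (t + 1)) :
    ((p ^ (t + 1)).choose (p ^ t + j) : R) = p * gammaCoeff p m (t + 1) R j := by
  rw [gammaCoeff, Nat.add_sub_cancel]
  by_cases hd : p ^ t ∣ j
  · obtain ⟨a, rfl⟩ := hd
    have hadd : p ^ t + p ^ t * a = (a + 1) * p ^ t := by ring
    rw [hadd] at hj ⊢
    have ha : a + 1 < p := Nat.lt_of_mul_lt_mul_right (hj.trans_eq (pow_succ' p t))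
    have hdvd : p ∣ (p ^ (t + 1)).choose ((a + 1) * p ^ t) :=
      (pow_one p).symm.dvd.trans
        ((prime_pow_dvd_choose_mul_prime_pow_iff hp t a.succ_ne_zero ha).2 le_rfl)
    rw [Nat.mul_div_cancel_left a (pow_pos hp.pos t), if_pos ⟨dvd_mul_right _ _, ha⟩,
      (h.isSquareZeroReduction hp).mul_eq_mul_iff.2 (residue_teichmullerRep h hp _),
      ← Nat.cast_mul, Nat.mul_div_cancel' hdvd]
  · rw [if_neg fun hc => hd hc.1, mul_zero]
    exact h.choose_eq_zero hp hj.le (by rwa [Nat.dvd_add_right dvd_rfl])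

theorem IsGaloisRing.residue_gammaCoeff_zero_ne_zero (h : IsGaloisRing p 2 m R) (hp : p.Prime)
    (t : ℕ) : residue R (gammaCoeff p m (t + 1) R 0) ≠ 0 := by
  have := (h.isSquareZeroReduction hp).charP_residueField hp
  have hdvd {e : ℕ} := prime_pow_dvd_choose_mul_prime_pow_iff hp (e := e) t one_ne_zero hp.one_lt
  rw [gammaCoeff, if_pos ⟨dvd_zero _, by rw [Nat.zero_div, zero_add]; exact hp.two_le⟩,
    residue_teichmullerRep h hp, map_natCast, Nat.zero_div, Nat.add_sub_cancel, zero_add, Ne,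
    CharP.cast_eq_zero_iff _ p,
    Nat.dvd_div_iff_mul_dvd ((pow_one p).symm.dvd.trans (hdvd.2 le_rfl)), ← sq, hdvd]
  exact Nat.not_succ_le_self 1

theorem IsGaloisRing.expansion_choose_pow_eq_one (h : IsGaloisRing p 2 m R) (hp : p.Prime)
    (t N : ℕ) :
    expansion N (p ^ t) (fun j => ((p ^ (t + 1)).choose j : R)) = 1 := by
  obtain ⟨q, hq⟩ := Nat.exists_eq_add_one_of_ne_zero (pow_ne_zero t hp.ne_zero)
  have hle : p ^ t ≤ p ^ (t + 1) := Nat.pow_le_pow_right hp.pos t.le_succ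
  rw [hq, expansion_succ, expansion_of_forall_eq_zero, mul_zero, add_zero, Nat.choose_zero_right,
    Nat.cast_one, map_one]
  intro j hj
  exact h.choose_eq_zero hp (by omega) (Nat.not_dvd_of_pos_of_lt j.succ_pos (by omega))

/-- The sum `∑ γ_j (x - 1)^j` in `R[x] / ⟨x^(p^s) - 1⟩`. -/
noncomputable def gammaSum (p m s : ℕ) (R : Type*) [CommRing R] : CyclicAmbient R (p ^ s) :=
  expansion (p ^ s) (p ^ s) (gammaCoeff p m s R)

theorem IsGaloisRing.xSubOne_pow_eq_neg (h : IsGaloisRing p 2 m R) (hp : p.Prime) (t : ℕ) :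
    xSubOne R (p ^ (t + 1)) ^ p ^ (t + 1) =
      -(p * (xSubOne R (p ^ (t + 1)) ^ p ^ t * gammaSum p m (t + 1) R)) := by
  obtain ⟨d, hd⟩ := Nat.exists_eq_add_of_le (Nat.pow_le_pow_right hp.pos t.le_succ)
  set N := p ^ (t + 1)
  have htop : expansion N d (fun j => (N.choose (p ^ t + j) : R)) = p * gammaSum p m (t + 1) R := by
    rw [gammaSum, expansion_of_le N (M := d) (by omega) fun j hj =>
      gammaCoeff_eq_zero m hp (by omega), ← map_natCast (AdjoinRoot.of (X ^ N - 1 : R[X])),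
      ← expansion_const_mul]
    exact expansion_congr N fun j hj => h.choose_eq_mul_gammaCoeff hp (by omega)
  have hsplit : expansion N (N + 1) (fun j => (N.choose j : R)) =
      1 + xSubOne R N ^ p ^ t * (p * gammaSum p m (t + 1) R) + xSubOne R N ^ N := by
    rw [expansion, Finset.sum_range_succ, ← expansion, Nat.choose_self, Nat.cast_one, map_one,
      one_mul, ← htop, ← h.expansion_choose_pow_eq_one hp t N, ← expansion_add, ← hd]
  rw [expansion_choose_eq_one] at hsplit
  linear_combination -hsplit

theorem IsGaloisRing.isUnit_reduction_gammaSum (h : IsGaloisRing p 2 m R) (hp : p.Prime) (t : ℕ) :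
    IsUnit (reduction R _ (gammaSum p m (t + 1) R)) := by
  have := (h.isSquareZeroReduction hp).charP_residueField hp
  have := Fact.mk hp
  rw [gammaSum, reduction_expansion]
  exact isUnit_expansion (pow_ne_zero _ hp.ne_zero) (h.residue_gammaCoeff_zero_ne_zero hp t)

end Gamma

section TorsionalDegree

open IsLocalRing

variable {p : ℕ} {R : Type*} [CommRing R] [IsLocalRing R]

theorem torsionCode_eq_torsionIdeal {N : ℕ} (i : ℕ) (C : Ideal (CyclicAmbient R N)) :
    torsionCode p i C = (torsionIdeal (reduction R N) (p ^ i) C : Set _) :=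
  Set.ext fun _ => (mem_torsionIdeal (reduction_surjective N)).symm

section

variable [Fact p.Prime] [CharP (ResidueField R) p] {s : ℕ}

theorem torsionalDegree_eq {i T : ℕ} {C : Ideal (CyclicAmbient R (p ^ s))} (hT : T ≤ p ^ s)
    (hC : torsionIdeal (reduction R (p ^ s)) (p ^ i) C =
      Ideal.span {xSubOne (ResidueField R) (p ^ s) ^ T}) : torsionalDegree p i C = T := by
  have hset : {T | T ≤ p ^ s ∧ torsionCode p i C =
      (Ideal.span {xSubOne (ResidueField R) (p ^ s) ^ T} : Set _)} = {T} := by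
    simp only [torsionCode_eq_torsionIdeal, hC, SetLike.coe_set_eq]
    exact Set.eq_singleton_iff_unique_mem.2
      ⟨⟨hT, rfl⟩, fun T' hT' => (span_xSubOne_pow_injective hT hT'.1 hT'.2).symm⟩
  rw [torsionalDegree, hset, csInf_singleton]

theorem torsionalDegree_spec (i : ℕ) (C : Ideal (CyclicAmbient R (p ^ s))) :
    torsionalDegree p i C ≤ p ^ s ∧ torsionIdeal (reduction R (p ^ s)) (p ^ i) C =
      Ideal.span {xSubOne (ResidueField R) (p ^ s) ^ torsionalDegree p i C} := by
  obtain ⟨T, hT, hC⟩ := exists_eq_span_xSubOne_pow (torsionIdeal (reduction R (p ^ s)) (p ^ i) C)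
  rw [torsionalDegree_eq hT hC]
  exact ⟨hT, hC⟩

theorem torsionCode_eq_span (i : ℕ) (C : Ideal (CyclicAmbient R (p ^ s))) :
    torsionCode p i C =
      (Ideal.span {xSubOne (ResidueField R) (p ^ s) ^ torsionalDegree p i C} : Set _) := by
  rw [torsionCode_eq_torsionIdeal, (torsionalDegree_spec i C).2]

theorem map_reduction_eq_span (C : Ideal (CyclicAmbient R (p ^ s))) :
    C.map (reduction R (p ^ s)) =
      Ideal.span {xSubOne (ResidueField R) (p ^ s) ^ torsionalDegree p 0 C} := by
  rw [← torsionIdeal_one, ← (torsionalDegree_spec 0 C).2, pow_zero]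

theorem torsionIdeal_natCast_eq_span (C : Ideal (CyclicAmbient R (p ^ s))) :
    torsionIdeal (reduction R (p ^ s)) p C =
      Ideal.span {xSubOne (ResidueField R) (p ^ s) ^ torsionalDegree p 1 C} := by
  rw [← (torsionalDegree_spec 1 C).2, pow_one]

theorem torsionalDegree_one_le (C : Ideal (CyclicAmbient R (p ^ s))) :
    torsionalDegree p 1 C ≤ torsionalDegree p 0 C := by
  refine le_of_span_xSubOne_pow_le (R := ResidueField R) (torsionalDegree_spec 1 C).1 ?_
  rw [← map_reduction_eq_span, ← torsionIdeal_natCast_eq_span, ← torsionIdeal_one]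
  exact torsionIdeal_one_le _ _ C

end

theorem reduction_xSubOne_pow (N i : ℕ) :
    reduction R N (xSubOne R N ^ i) = xSubOne (ResidueField R) N ^ i := by
  rw [map_pow, reduction_xSubOne]

theorem IsSquareZeroReduction.torsionalDegree_span_natCast_mul
    (h : IsSquareZeroReduction (p : R) (residue R)) (hp : p.Prime) {s n : ℕ} (hn : n ≤ p ^ s)
    {C : Ideal (CyclicAmbient R (p ^ s))} (hC : C = Ideal.span {p * xSubOne R (p ^ s) ^ n}) :
    torsionalDegree p 0 C = p ^ s ∧ torsionalDegree p 1 C = n := by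
  have := h.charP_residueField hp
  have := Fact.mk hp
  have hred := h.cyclicAmbient (pow_ne_zero s hp.ne_zero)
  replace hC : C = Ideal.span {0, p * xSubOne R (p ^ s) ^ n} :=
    hC.trans Submodule.span_insert_zero.symm
  constructor
  · refine torsionalDegree_eq le_rfl ?_
    rw [pow_zero, torsionIdeal_one, hC, hred.map_span_pair, map_zero,
      xSubOne_pow_eq_zero_iff.2 le_rfl]
  · refine torsionalDegree_eq hn ?_
    rw [pow_one, hC, hred.torsionIdeal_span_pair (d := 1) (e := 0)
      (by rw [mul_zero, mul_zero]) fun b _ => by rw [map_one]; exact one_dvd b, map_zero,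
      reduction_xSubOne_pow]
    exact Submodule.span_insert_zero.trans Submodule.span_insert_zero

variable {m : ℕ}

theorem IsGaloisRing.torsionalDegree_span_pair (h : IsGaloisRing p 2 m R) (hp : p.Prime)
    {t k e : ℕ} (hk : k ≤ p ^ (t + 1)) {n : ℕ} {a : CyclicAmbient R (p ^ (t + 1))}
    (ha : Ideal.span {xSubOne (ResidueField R) (p ^ (t + 1)) ^ (p ^ (t + 1) - k) *
        reduction R _ a - xSubOne (ResidueField R) (p ^ (t + 1)) ^ p ^ t *
          reduction R _ (gammaSum p m (t + 1) R)} =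
      Ideal.span {xSubOne (ResidueField R) (p ^ (t + 1)) ^ e})
    {C : Ideal (CyclicAmbient R (p ^ (t + 1)))}
    (hC : C = Ideal.span {xSubOne R (p ^ (t + 1)) ^ k + p * a, p * xSubOne R (p ^ (t + 1)) ^ n}) :
    torsionalDegree p 0 C = k ∧ torsionalDegree p 1 C = min k (min e n) := by
  have hred := (h.isSquareZeroReduction hp).cyclicAmbient (pow_ne_zero (t + 1) hp.ne_zero)
  have := (h.isSquareZeroReduction hp).charP_residueField hp
  have := Fact.mk hp
  subst hC
  set u := xSubOne R (p ^ (t + 1))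
  have hf : reduction R (p ^ (t + 1)) (u ^ k + p * a) =
      xSubOne (ResidueField R) (p ^ (t + 1)) ^ k := by
    rw [map_add, map_mul, hred.map_self, zero_mul, add_zero, reduction_xSubOne_pow]
  constructor
  · refine torsionalDegree_eq hk ?_
    rw [pow_zero, torsionIdeal_one, hred.map_span_pair, hf]
  · refine torsionalDegree_eq ((min_le_left _ _).trans hk) ?_
    -- The factor `u ^ (p ^ (t + 1) - k)` turns `u ^ k` into a multiple of `p`.
    have hmul : u ^ (p ^ (t + 1) - k) * (u ^ k + p * a) =
        p * (u ^ (p ^ (t + 1) - k) * a - u ^ p ^ t * gammaSum p m (t + 1) R) := by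
      rw [mul_add, ← pow_add, Nat.sub_add_cancel hk, h.xSubOne_pow_eq_neg hp t]
      ring
    have hann : ∀ b, b * reduction R (p ^ (t + 1)) (u ^ k + p * a) = 0 →
        reduction R _ (u ^ (p ^ (t + 1) - k)) ∣ b := by
      intro b hb
      rw [hf, mul_comm] at hb
      rw [reduction_xSubOne_pow]
      exact xSubOne_pow_sub_dvd_of_pow_mul_eq_zero hb
    rw [pow_one, hred.torsionIdeal_span_pair hmul hann, hf, map_sub, map_mul, map_mul]
    simp only [u, reduction_xSubOne_pow]
    rw [Ideal.span_insert, Ideal.span_insert, ha, span_pow_sup_span_pow, span_pow_sup_span_pow]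

theorem IsGaloisRing.torsionalDegree_span_pow_pair (h : IsGaloisRing p 2 m R) (hp : p.Prime)
    {t k n : ℕ} (hk : k ≤ p ^ (t + 1)) {C : Ideal (CyclicAmbient R (p ^ (t + 1)))}
    (hC : C = Ideal.span {xSubOne R (p ^ (t + 1)) ^ k, p * xSubOne R (p ^ (t + 1)) ^ n}) :
    torsionalDegree p 0 C = k ∧ torsionalDegree p 1 C = min k (min (p ^ t) n) := by
  refine h.torsionalDegree_span_pair hp hk (a := 0) ?_ (by rw [hC, mul_zero, add_zero])
  rw [map_zero, mul_zero, zero_sub, Ideal.span_singleton_neg]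
  exact Ideal.span_singleton_mul_right_unit (h.isUnit_reduction_gammaSum hp t) _

theorem IsGaloisRing.torsionalDegree_span_pow (h : IsGaloisRing p 2 m R) (hp : p.Prime)
    {t k : ℕ} (hk : k ≤ p ^ (t + 1)) {C : Ideal (CyclicAmbient R (p ^ (t + 1)))}
    (hC : C = Ideal.span {xSubOne R (p ^ (t + 1)) ^ k}) :
    torsionalDegree p 0 C = k ∧ torsionalDegree p 1 C = min k (p ^ t) := by
  have hred := (h.isSquareZeroReduction hp).cyclicAmbient (pow_ne_zero (t + 1) hp.ne_zero)
  have hspan := hred.span_pair_mul_eq (xSubOne R (p ^ (t + 1)) ^ k) 0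
  rw [mul_zero, add_zero] at hspan
  have hpair := h.torsionalDegree_span_pow_pair hp hk (hC.trans hspan.symm)
  rwa [min_comm (p ^ t), ← min_assoc, min_self] at hpair

end TorsionalDegree

section Delta

open IsLocalRing

theorem eq_of_lt_firstDiff {p m s j : ℕ} {R : Type*} [CommRing R] {η : ℕ → R}
    (hj : j < firstDiff p m s η) : gammaCoeff p m s R j = η j :=
  of_not_not fun hne => Nat.notMem_of_lt_sInf hj (Or.inl hne)

theorem firstDiff_le (p m s : ℕ) {R : Type*} [CommRing R] (η : ℕ → R) :
    firstDiff p m s η ≤ p ^ s :=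
  Nat.sInf_le (Or.inr rfl)

theorem ne_of_firstDiff_lt {p m s : ℕ} {R : Type*} [CommRing R] {η : ℕ → R}
    (h : firstDiff p m s η < p ^ s) :
    gammaCoeff p m s R (firstDiff p m s η) ≠ η (firstDiff p m s η) :=
  (Nat.sInf_mem (s := {j | gammaCoeff p m s R j ≠ η j} ∪ {p ^ s}) ⟨_, Or.inr rfl⟩).resolve_right
    h.ne

theorem pow_eq_self_of_mem_teichmullerSet {p m : ℕ} (hp : p ≠ 0) {R : Type*} [CommRing R] {x : R}
    (hx : x ∈ teichmullerSet p m R) : x ^ p ^ m = x := by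
  have hne : p ^ m ≠ 0 := pow_ne_zero m hp
  rcases hx with rfl | hx
  · exact zero_pow hne
  · rw [← Nat.sub_add_cancel (Nat.one_le_iff_ne_zero.2 hne), pow_succ, hx, one_mul]

theorem zero_mem_teichmullerSet (p m : ℕ) (R : Type*) [CommRing R] : 0 ∈ teichmullerSet p m R :=
  Or.inl rfl

variable {p m : ℕ} {R : Type*} [CommRing R] [IsLocalRing R]

theorem IsGaloisRing.degree_ne_zero (h : IsGaloisRing p 2 m R) : m ≠ 0 := by
  rintro rfl
  have := (Nat.card_eq_one_iff_unique.1 h.card_eq).1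
  exact not_subsingleton R this

theorem IsGaloisRing.residue_injOn_teichmullerSet (h : IsGaloisRing p 2 m R) (hp : p.Prime) :
    Set.InjOn (residue R) (teichmullerSet p m R) := by
  intro x hx y hy hxy
  have hm : 2 ≤ m + 1 := Nat.succ_le_succ (Nat.one_le_iff_ne_zero.2 h.degree_ne_zero)
  have hdvd : (p : R) ∣ x - y :=
    ((h.isSquareZeroReduction hp).map_eq_zero_iff_dvd _).1 (by rw [map_sub, hxy, sub_self])
  have hpow := dvd_sub_pow_of_dvd_sub hdvd m
  rwa [pow_eq_self_of_mem_teichmullerSet hp.ne_zero hx,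
    pow_eq_self_of_mem_teichmullerSet hp.ne_zero hy,
    pow_eq_zero_of_le hm (by rw [sq, h.p_sq]), zero_dvd_iff, sub_eq_zero] at hpow

theorem IsGaloisRing.gammaCoeff_mem (h : IsGaloisRing p 2 m R) (hp : p.Prime) (s j : ℕ) :
    gammaCoeff p m s R j ∈ teichmullerSet p m R := by
  rw [gammaCoeff]
  split_ifs
  · exact teichmullerRep_mem h hp _
  · exact zero_mem_teichmullerSet p m R

theorem reduction_deltaPoly {N k l : ℕ} {η : ℕ → R} (hk : k ≤ N) (hη : IsDeltaCoeff p m k l η) :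
    reduction R N (deltaPoly N k l η) = expansion N N (residue R ∘ η) := by
  rw [← reduction_expansion, expansion_of_le N ((k.sub_le l).trans hk) hη.eq_zero]
  rfl

theorem IsGaloisRing.isUnit_reduction_deltaPoly (h : IsGaloisRing p 2 m R) (hp : p.Prime)
    {s k l : ℕ} {η : ℕ → R} (hk : k ≤ p ^ s) (hη : IsDeltaCoeff p m k l η) :
    IsUnit (reduction R (p ^ s) (deltaPoly (p ^ s) k l η)) := by
  have := (h.isSquareZeroReduction hp).charP_residueField hp
  have := Fact.mk hp
  rw [reduction_deltaPoly hk hη]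
  refine isUnit_expansion (pow_ne_zero s hp.ne_zero) fun h0 => hη.zero_ne ?_
  exact h.residue_injOn_teichmullerSet hp (hη.mem 0) (zero_mem_teichmullerSet p m R)
    (h0.trans (map_zero _).symm)

theorem IsGaloisRing.span_pow_mul_deltaPoly_sub_gammaSum (h : IsGaloisRing p 2 m R) (hp : p.Prime)
    {s k l : ℕ} {η : ℕ → R} (hk : k ≤ p ^ s) (hη : IsDeltaCoeff p m k l η) (a : ℕ) :
    Ideal.span {xSubOne (ResidueField R) (p ^ s) ^ a *
        (reduction R _ (deltaPoly (p ^ s) k l η) - reduction R _ (gammaSum p m s R))} =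
      Ideal.span {xSubOne (ResidueField R) (p ^ s) ^ (a + firstDiff p m s η)} := by
  have := (h.isSquareZeroReduction hp).charP_residueField hp
  have := Fact.mk hp
  have hagree : ∀ j < firstDiff p m s η, (residue R ∘ η - residue R ∘ gammaCoeff p m s R) j = 0 :=
    fun j hj => sub_eq_zero.2 (congrArg (residue R) (eq_of_lt_firstDiff hj).symm)
  rw [reduction_deltaPoly hk hη, gammaSum, reduction_expansion, ← expansion_sub]
  rcases (firstDiff_le p m s η).eq_or_lt with heq | hlt
  · rw [expansion_of_forall_eq_zero _ (heq ▸ hagree), mul_zero, heq,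
      xSubOne_pow_eq_zero_iff.2 (Nat.le_add_left _ a)]
  · refine span_xSubOne_pow_mul_expansion hlt hagree fun h0 => ne_of_firstDiff_lt hlt ?_
    exact h.residue_injOn_teichmullerSet hp (h.gammaCoeff_mem hp s _) (hη.mem _)
      (sub_eq_zero.1 h0).symm

theorem IsGaloisRing.torsionalDegree_span_delta_pair (h : IsGaloisRing p 2 m R) (hp : p.Prime)
    {t k l n : ℕ} {η : ℕ → R} (hk : k ≤ p ^ (t + 1)) (hη : IsDeltaCoeff p m k l η)
    {C : Ideal (CyclicAmbient R (p ^ (t + 1)))}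
    (hC : C = Ideal.span {xSubOne R (p ^ (t + 1)) ^ k +
      p * xSubOne R (p ^ (t + 1)) ^ l * deltaPoly (p ^ (t + 1)) k l η,
      p * xSubOne R (p ^ (t + 1)) ^ n}) :
    torsionalDegree p 0 C = k ∧
      (p ^ t ≠ p ^ (t + 1) - k + l →
        torsionalDegree p 1 C = min k (min (p ^ t) (min (p ^ (t + 1) - k + l) n))) ∧
      (p ^ t = p ^ (t + 1) - k + l →
        torsionalDegree p 1 C = min k (min (p ^ t + firstDiff p m (t + 1) η) n)) := by
  have := (h.isSquareZeroReduction hp).charP_residueField hp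
  have := Fact.mk hp
  have hpair {e} := h.torsionalDegree_span_pair hp hk (e := e) (n := n) (C := C)
    (a := xSubOne R (p ^ (t + 1)) ^ l * deltaPoly (p ^ (t + 1)) k l η)
  simp only [map_mul, reduction_xSubOne_pow, ← mul_assoc, ← pow_add] at hpair
  by_cases heq : p ^ t = p ^ (t + 1) - k + l
  · have hspan := h.span_pow_mul_deltaPoly_sub_gammaSum hp hk hη (p ^ t)
    rw [mul_sub] at hspan
    rw [← heq] at hpair
    exact ⟨(hpair hspan hC).1, fun hne => absurd heq hne, fun _ => (hpair hspan hC).2⟩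
  · have hspan := span_pow_mul_isUnit_sub isNilpotent_xSubOne (Ne.symm heq)
      (h.isUnit_reduction_deltaPoly hp hk hη) (h.isUnit_reduction_gammaSum hp t)
    rw [min_comm] at hspan
    exact ⟨(hpair hspan hC).1, fun _ => min_assoc (p ^ t) _ n ▸ (hpair hspan hC).2,
      fun he => absurd he heq⟩

theorem IsGaloisRing.torsionalDegree_span_delta (h : IsGaloisRing p 2 m R) (hp : p.Prime)
    {t k l : ℕ} {η : ℕ → R} (hk : k ≤ p ^ (t + 1)) (hη : IsDeltaCoeff p m k l η)
    {C : Ideal (CyclicAmbient R (p ^ (t + 1)))}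
    (hC : C = Ideal.span {xSubOne R (p ^ (t + 1)) ^ k +
      p * xSubOne R (p ^ (t + 1)) ^ l * deltaPoly (p ^ (t + 1)) k l η}) :
    torsionalDegree p 0 C = k ∧
      (p ^ t ≠ p ^ (t + 1) - k + l →
        torsionalDegree p 1 C = min k (min (p ^ t) (p ^ (t + 1) - k + l))) ∧
      (p ^ t = p ^ (t + 1) - k + l →
        torsionalDegree p 1 C = min k (p ^ t + firstDiff p m (t + 1) η)) := by
  have hred := (h.isSquareZeroReduction hp).cyclicAmbient (pow_ne_zero (t + 1) hp.ne_zero)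
  have hspan := hred.span_pair_mul_eq (xSubOne R (p ^ (t + 1)) ^ k)
    (xSubOne R (p ^ (t + 1)) ^ l * deltaPoly (p ^ (t + 1)) k l η)
  rw [← mul_assoc] at hspan
  obtain ⟨h0, h1, h2⟩ := h.torsionalDegree_span_delta_pair hp hk hη (hC.trans hspan.symm)
  refine ⟨h0, fun hne => (h1 hne).trans ?_, fun heq => (h2 heq).trans ?_⟩ <;> omega

end Delta

section Forms

open IsLocalRing

namespace IsSquareZeroReduction

variable {p : ℕ} {R : Type*} [CommRing R] [IsLocalRing R] {s : ℕ}

theorem natCast_mul_xSubOne_pow_mem (h : IsSquareZeroReduction (p : R) (residue R)) (hp : p.Prime)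
    (C : Ideal (CyclicAmbient R (p ^ s))) : p * xSubOne R (p ^ s) ^ torsionalDegree p 1 C ∈ C := by
  have := h.charP_residueField hp
  have := Fact.mk hp
  have hred := h.cyclicAmbient (pow_ne_zero s hp.ne_zero)
  obtain ⟨v, hv, hφ⟩ := (mem_torsionIdeal hred.surjective).1
    ((torsionIdeal_natCast_eq_span C).ge (Ideal.mem_span_singleton_self _))
  rwa [← hred.mul_eq_mul_iff.2 (hφ.trans (reduction_xSubOne_pow _ _).symm)]

theorem eq_span_pair_torsionalDegree (h : IsSquareZeroReduction (p : R) (residue R))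
    (hp : p.Prime) {C : Ideal (CyclicAmbient R (p ^ s))} {f : CyclicAmbient R (p ^ s)}
    (hf : f ∈ C)
    (hφ : reduction R _ f = xSubOne (ResidueField R) (p ^ s) ^ torsionalDegree p 0 C) :
    C = Ideal.span {f, p * xSubOne R (p ^ s) ^ torsionalDegree p 1 C} := by
  have := h.charP_residueField hp
  have := Fact.mk hp
  refine (h.cyclicAmbient (pow_ne_zero s hp.ne_zero)).eq_span_pair hf
    (h.natCast_mul_xSubOne_pow_mem hp C) ?_ ?_
  · rw [map_reduction_eq_span, hφ]
  · rw [torsionIdeal_natCast_eq_span, reduction_xSubOne_pow]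

theorem eq_span_natCast_mul_of_torsionalDegree_zero_eq
    (h : IsSquareZeroReduction (p : R) (residue R)) (hp : p.Prime)
    {C : Ideal (CyclicAmbient R (p ^ s))} (hC : torsionalDegree p 0 C = p ^ s) :
    C = Ideal.span {p * xSubOne R (p ^ s) ^ torsionalDegree p 1 C} := by
  have := h.charP_residueField hp
  have := Fact.mk hp
  refine (h.eq_span_pair_torsionalDegree hp C.zero_mem ?_).trans Submodule.span_insert_zero
  rw [map_zero, hC, xSubOne_pow_eq_zero_iff.2 le_rfl]

theorem exists_add_mul_mem (h : IsSquareZeroReduction (p : R) (residue R)) (hp : p.Prime)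
    (C : Ideal (CyclicAmbient R (p ^ s))) :
    ∃ a, xSubOne R (p ^ s) ^ torsionalDegree p 0 C + p * a ∈ C := by
  have := h.charP_residueField hp
  have := Fact.mk hp
  have hred := h.cyclicAmbient (pow_ne_zero s hp.ne_zero)
  obtain ⟨f, hf, hφ⟩ := (Ideal.mem_map_iff_of_surjective _ hred.surjective).1
    ((map_reduction_eq_span C).ge (Ideal.mem_span_singleton_self _))
  obtain ⟨a, rfl⟩ := hred.exists_eq_add_mul (hφ.trans (reduction_xSubOne_pow _ _).symm)
  exact ⟨a, hf⟩

theorem natCast_mul_xSubOne_pow_eq_zero (h : IsSquareZeroReduction (p : R) (residue R))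
    (hp : p.Prime) : p * xSubOne R (p ^ s) ^ p ^ s = 0 := by
  have := h.charP_residueField hp
  have := Fact.mk hp
  rw [(h.cyclicAmbient (pow_ne_zero s hp.ne_zero)).mul_eq_zero_iff, reduction_xSubOne_pow,
    xSubOne_pow_eq_zero_iff]

end IsSquareZeroReduction

theorem expansion_eq_zero_or_eq_pow_mul_deltaPoly {p m : ℕ} {R : Type*} [CommRing R] (N : ℕ)
    {k n : ℕ} (hn : n ≤ k) {c : ℕ → R} (hc : ∀ j, c j ∈ teichmullerSet p m R) :
    expansion N n c = 0 ∨
      ∃ l η, IsDeltaCoeff p m k l η ∧ expansion N n c = xSubOne R N ^ l * deltaPoly N k l η := by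
  classical
  refine or_iff_not_imp_left.2 fun hne => ?_
  have hex : ∃ j, j < n ∧ c j ≠ 0 := by
    by_contra! hzero
    exact hne (expansion_of_forall_eq_zero N hzero)
  obtain ⟨hl, hcl⟩ := Nat.find_spec hex
  have hmin : ∀ j < Nat.find hex, c j = 0 := fun j hj =>
    of_not_not fun hj0 => Nat.find_min hex hj ⟨hj.trans hl, hj0⟩
  generalize Nat.find hex = l at hl hcl hmin
  let η : ℕ → R := fun j => if l + j < n then c (l + j) else 0
  have hη : ∀ j, n - l ≤ j → η j = 0 := fun j hj => if_neg (by omega)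
  refine ⟨l, η, ⟨hl.trans_le hn, fun j => ?_, ?_, fun j hj => hη j (by omega)⟩, ?_⟩
  · simp only [η]
    split_ifs
    exacts [hc _, zero_mem_teichmullerSet p m R]
  · exact (if_pos hl : η 0 = c l).trans_ne hcl
  · change _ = _ * expansion N (k - l) η
    rw [expansion_eq_pow_mul N hl.le hmin, expansion_of_le N (Nat.sub_le_sub_right hn l) hη]
    exact congrArg _ (expansion_congr N fun j hj => (if_pos (by omega)).symm)

namespace IsGaloisRing

variable {p m : ℕ} {R : Type*} [CommRing R] [IsLocalRing R]

theorem exists_natCast_mul_eq_natCast_mul_expansion (h : IsGaloisRing p 2 m R) (hp : p.Prime)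
    {N : ℕ} (hN : N ≠ 0) (n : ℕ) (a : CyclicAmbient R N) :
    ∃ c : ℕ → R, (∀ j, c j ∈ teichmullerSet p m R) ∧
      ∃ v, p * a = p * expansion N n c + v * (p * xSubOne R N ^ n) := by
  obtain ⟨c, v, rfl⟩ := exists_eq_expansion_add n a
  refine ⟨fun j => teichmullerRep p m (c j), fun j => teichmullerRep_mem h hp (c j), v, ?_⟩
  have hc : residue R ∘ (fun j => teichmullerRep p m (c j)) = residue R ∘ c :=
    funext fun j => residue_teichmullerRep h hp (c j)
  have hexp : (p : CyclicAmbient R N) * expansion N n (fun j => teichmullerRep p m (c j)) =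
      p * expansion N n c :=
    ((h.isSquareZeroReduction hp).cyclicAmbient hN).mul_eq_mul_iff.2 (by
      rw [reduction_expansion, reduction_expansion, hc])
  rw [hexp]
  ring

theorem exists_eq_span_pair_expansion (h : IsGaloisRing p 2 m R) (hp : p.Prime) {s : ℕ}
    (C : Ideal (CyclicAmbient R (p ^ s))) :
    ∃ c : ℕ → R, (∀ j, c j ∈ teichmullerSet p m R) ∧
      C = Ideal.span {xSubOne R (p ^ s) ^ torsionalDegree p 0 C +
        p * expansion (p ^ s) (torsionalDegree p 1 C) c,
        p * xSubOne R (p ^ s) ^ torsionalDegree p 1 C} := by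
  have hsq := h.isSquareZeroReduction hp
  have hred := hsq.cyclicAmbient (pow_ne_zero s hp.ne_zero)
  obtain ⟨a, ha⟩ := hsq.exists_add_mul_mem hp C
  obtain ⟨c, hc, v, hv⟩ := h.exists_natCast_mul_eq_natCast_mul_expansion hp
    (pow_ne_zero s hp.ne_zero) (torsionalDegree p 1 C) a
  rw [hv, ← add_assoc, C.add_mem_iff_left
    (C.mul_mem_left v (hsq.natCast_mul_xSubOne_pow_mem hp C))] at ha
  refine ⟨c, hc, hsq.eq_span_pair_torsionalDegree hp ha ?_⟩
  rw [map_add, map_mul, hred.map_self, zero_mul, add_zero, reduction_xSubOne_pow]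

theorem eq_span_of_torsionalDegree_eq (h : IsGaloisRing p 2 m R) (hp : p.Prime) {s : ℕ}
    (C : Ideal (CyclicAmbient R (p ^ s))) {k n : ℕ} (hk : torsionalDegree p 0 C = k)
    (hn : torsionalDegree p 1 C = n) :
    C = Ideal.span {xSubOne R (p ^ s) ^ k, p * xSubOne R (p ^ s) ^ n} ∨
      ∃ (l : ℕ) (η : ℕ → R), IsDeltaCoeff p m k l η ∧
        C = Ideal.span {xSubOne R (p ^ s) ^ k +
          p * xSubOne R (p ^ s) ^ l * deltaPoly (p ^ s) k l η, p * xSubOne R (p ^ s) ^ n} := by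
  have := (h.isSquareZeroReduction hp).charP_residueField hp
  have := Fact.mk hp
  obtain ⟨c, hc, hC⟩ := h.exists_eq_span_pair_expansion hp C
  have hle := torsionalDegree_one_le C
  rw [hk, hn] at hC hle
  rcases expansion_eq_zero_or_eq_pow_mul_deltaPoly (p ^ s) hle hc with h0 | ⟨l, η, hη, hexp⟩
  · exact Or.inl (by rwa [h0, mul_zero, add_zero] at hC)
  · exact Or.inr ⟨l, η, hη, by rwa [hexp, ← mul_assoc] at hC⟩

theorem ideal_forms (h : IsGaloisRing p 2 m R) (hp : p.Prime) {s : ℕ}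
    (C : Ideal (CyclicAmbient R (p ^ s))) :
    C = ⊥ ∨
      (∃ n, n < p ^ s ∧ C = Ideal.span {p * xSubOne R (p ^ s) ^ n}) ∨
      (∃ k, k < p ^ s ∧ C = Ideal.span {xSubOne R (p ^ s) ^ k}) ∨
      (∃ (k l : ℕ) (η : ℕ → R), k < p ^ s ∧ IsDeltaCoeff p m k l η ∧
        C = Ideal.span {xSubOne R (p ^ s) ^ k +
          p * xSubOne R (p ^ s) ^ l * deltaPoly (p ^ s) k l η}) ∨
      (∃ k n : ℕ, k < p ^ s ∧ n < k ∧
        C = Ideal.span {xSubOne R (p ^ s) ^ k, p * xSubOne R (p ^ s) ^ n}) ∨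
      (∃ (k l n : ℕ) (η : ℕ → R), k < p ^ s ∧ n < k ∧ IsDeltaCoeff p m k l η ∧
        C = Ideal.span {xSubOne R (p ^ s) ^ k +
          p * xSubOne R (p ^ s) ^ l * deltaPoly (p ^ s) k l η,
          p * xSubOne R (p ^ s) ^ n}) := by
  have hsq := h.isSquareZeroReduction hp
  have hred := hsq.cyclicAmbient (pow_ne_zero s hp.ne_zero)
  have := hsq.charP_residueField hp
  have := Fact.mk hp
  rcases (torsionalDegree_spec 0 C).1.eq_or_lt with hk | hk
  · have hC := hsq.eq_span_natCast_mul_of_torsionalDegree_zero_eq hp hk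
    rcases (torsionalDegree_spec 1 C).1.eq_or_lt with hn | hn
    · rw [hn, hsq.natCast_mul_xSubOne_pow_eq_zero hp] at hC
      exact Or.inl (hC.trans (Ideal.span_singleton_eq_bot.2 rfl))
    · exact Or.inr (Or.inl ⟨_, hn, hC⟩)
  refine Or.inr (Or.inr ?_)
  rcases h.eq_span_of_torsionalDegree_eq hp C rfl rfl with hC | ⟨l, η, hη, hC⟩ <;>
    rcases (torsionalDegree_one_le C).eq_or_lt with hn | hn
  · have hdrop := hred.span_pair_mul_eq (xSubOne R (p ^ s) ^ torsionalDegree p 0 C) 0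
    rw [mul_zero, add_zero] at hdrop
    rw [hn, hdrop] at hC
    exact Or.inl ⟨_, hk, hC⟩
  · exact Or.inr (Or.inr (Or.inl ⟨_, _, hk, hn, hC⟩))
  · rw [hn, mul_assoc, hred.span_pair_mul_eq, ← mul_assoc] at hC
    exact Or.inr (Or.inl ⟨_, l, η, hk, hη, hC⟩)
  · exact Or.inr (Or.inr (Or.inr ⟨_, l, _, η, hk, hn, hη, hC⟩))

end IsGaloisRing

end Forms

section HammingDistance

open IsLocalRing

theorem sInf_eq_of_subset_of_forall_exists_le {S T : Set ℕ} (hTS : T ⊆ S)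
    (hST : ∀ w ∈ S, ∃ w' ∈ T, w' ≤ w) : sInf S = sInf T := by
  rcases S.eq_empty_or_nonempty with rfl | hS
  · rw [Set.subset_empty_iff.1 hTS]
  · obtain ⟨w, hw, hle⟩ := hST _ (Nat.sInf_mem hS)
    exact le_antisymm (Nat.sInf_le (hTS (Nat.sInf_mem ⟨w, hw⟩))) ((Nat.sInf_le hw).trans hle)

variable {p : ℕ} {R : Type*} [CommRing R] [IsLocalRing R]

theorem IsSquareZeroReduction.mk_C_natCast_mul_mem_iff
    (h : IsSquareZeroReduction (p : R) (residue R)) {N : ℕ} (hN : N ≠ 0)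
    {I : Ideal (CyclicAmbient R N)} {g : R[X]} :
    AdjoinRoot.mk (X ^ N - 1 : R[X]) (C (p : R) * g) ∈ I ↔
      AdjoinRoot.mk _ (g.map (residue R)) ∈ torsionIdeal (reduction R N) p I := by
  rw [map_mul, AdjoinRoot.mk_C, map_natCast, mem_torsionIdeal (reduction_surjective N)]
  refine ⟨fun hg => ⟨_, hg, reduction_mk g⟩, ?_⟩
  rintro ⟨v, hv, hφ⟩
  rwa [← (h.cyclicAmbient hN).mul_eq_mul_iff.2 (hφ.trans (reduction_mk g).symm)]

-- A codeword either is `p g`, with as many nonzero coefficients as the reduction of `g`, or has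
-- nonzero reduction, which lies in the torsion code and is not heavier.
theorem IsSquareZeroReduction.hammingDistance_eq (h : IsSquareZeroReduction (p : R) (residue R))
    {N : ℕ} (hN : N ≠ 0) (I : Ideal (CyclicAmbient R N)) :
    hammingDistance I = hammingDistance (torsionIdeal (reduction R N) p I) := by
  have hdegree (g : R[X]) : (C (p : R) * g).degree = (g.map (residue R)).degree := by
    rw [degree, degree, h.support_C_mul]
  refine sInf_eq_of_subset_of_forall_exists_le ?_ ?_
  · rintro _ ⟨f, hf, hd, hm, rfl⟩
    obtain ⟨g, rfl⟩ := Polynomial.map_surjective _ residue_surjective f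
    exact ⟨C (p : R) * g, fun h0 => hf ((h.polynomial.mul_eq_zero_iff g).1 h0),
      (hdegree g).trans_lt hd, (h.mk_C_natCast_mul_mem_iff hN).2 hm,
      congrArg _ (h.support_C_mul g)⟩
  · rintro _ ⟨f, hf, hd, hm, rfl⟩
    by_cases h0 : f.map (residue R) = 0
    · obtain ⟨g, rfl⟩ := (h.polynomial.map_eq_zero_iff_dvd f).1 h0
      refine ⟨_, ⟨g.map (residue R), fun hg => hf ((h.polynomial.mul_eq_zero_iff g).2 hg),
        (hdegree g).symm.trans_lt hd, (h.mk_C_natCast_mul_mem_iff hN).1 hm, rfl⟩, ?_⟩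
      rw [h.support_C_mul]
    · refine ⟨_, ⟨f.map (residue R), h0, degree_map_le.trans_lt hd, ?_, rfl⟩,
        Finset.card_le_card (support_map_subset _ f)⟩
      refine (mem_torsionIdeal (reduction_surjective N)).2 ⟨_, ?_, reduction_mk f⟩
      exact I.mul_mem_left _ hm

theorem IsGaloisRing.hammingDistance_eq_span {m : ℕ} (h : IsGaloisRing p 2 m R) (hp : p.Prime)
    {s : ℕ} (I : Ideal (CyclicAmbient R (p ^ s))) :
    hammingDistance I = hammingDistance
      (Ideal.span {xSubOne (ResidueField R) (p ^ s) ^ torsionalDegree p 1 I}) := by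
  have hsq := h.isSquareZeroReduction hp
  have := hsq.charP_residueField hp
  have := Fact.mk hp
  rw [hsq.hammingDistance_eq (pow_ne_zero s hp.ne_zero), torsionIdeal_natCast_eq_span]

theorem hammingDistance_span_pow_eq {p t i d : ℕ} {F : Type*} [CommRing F] [IsDomain F]
    [Fact p.Prime] [CharP F p]
    (hd : d = hammingDistance (Ideal.span {xSubOne F (p ^ (t + 1)) ^ i})) :
    (i = 0 → d = 1) ∧
      (1 ≤ i → i ≤ p ^ t → d = 2) ∧
      (∀ β, 1 ≤ β → β ≤ p - 2 → β * p ^ t + 1 ≤ i → i ≤ (β + 1) * p ^ t → d = β + 2) ∧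
      (∀ τ k, 1 ≤ τ → τ ≤ p - 1 → 1 ≤ k → k ≤ t →
        p ^ (t + 1) - p ^ (t + 1 - k) + (τ - 1) * p ^ (t + 1 - k - 1) + 1 ≤ i →
        i ≤ p ^ (t + 1) - p ^ (t + 1 - k) + τ * p ^ (t + 1 - k - 1) → d = (τ + 1) * p ^ k) := by
  have hp := (Fact.out : p.Prime)
  subst hd
  refine ⟨?_, fun h1 h2 => ?_, fun β _ hβ h1 h2 => ?_, fun τ k hτ0 hτ _ hk h1 h2 => ?_⟩
  · rintro rfl
    exact hammingDistance_span_pow_zero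
  · exact hammingDistance_span_eq_add_two (b := 0) hp.one_lt (by omega) (by omega)
  · exact hammingDistance_span_eq_add_two (by have := hp.two_le; omega) h1 h2
  · obtain ⟨b, rfl⟩ := Nat.exists_eq_add_of_le' hτ0
    obtain ⟨r, rfl⟩ := Nat.exists_eq_add_of_le' hk
    rw [Nat.add_right_comm r k 1] at h1 h2 ⊢
    simp only [Nat.add_sub_cancel] at h1 h2
    exact hammingDistance_span_eq_mul_pow (by have := hp.two_le; omega) h1 h2

end HammingDistance

theorem lemma4p8 (p m s : ℕ) (hp : p.Prime) (hs : 1 ≤ s)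
    (R : Type*) [CommRing R] [IsLocalRing R] (hR : IsGaloisRing p 2 m R) :
    -- every cyclic code has one of the listed forms
    (∀ C : Ideal (CyclicAmbient R (p ^ s)),
      C = ⊥ ∨ C = ⊤ ∨
      (∃ n, n < p ^ s ∧
        C = Ideal.span {(p : CyclicAmbient R (p ^ s)) * xSubOne R (p ^ s) ^ n}) ∨
      (∃ k, k < p ^ s ∧ C = Ideal.span {xSubOne R (p ^ s) ^ k}) ∨
      (∃ (k l : ℕ) (η : ℕ → R), k < p ^ s ∧ IsDeltaCoeff p m k l η ∧
        C = Ideal.span {xSubOne R (p ^ s) ^ k +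
          p * xSubOne R (p ^ s) ^ l * deltaPoly (p ^ s) k l η}) ∨
      (∃ k n : ℕ, k < p ^ s ∧ n < k ∧
        C = Ideal.span {xSubOne R (p ^ s) ^ k, p * xSubOne R (p ^ s) ^ n}) ∨
      (∃ (k l n : ℕ) (η : ℕ → R), k < p ^ s ∧ n < k ∧ IsDeltaCoeff p m k l η ∧
        C = Ideal.span {xSubOne R (p ^ s) ^ k +
          p * xSubOne R (p ^ s) ^ l * deltaPoly (p ^ s) k l η,
          p * xSubOne R (p ^ s) ^ n})) ∧
    -- the torsional degrees are well defined
    (∀ C : Ideal (CyclicAmbient R (p ^ s)), ∀ i < 2,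
      torsionalDegree p i C ≤ p ^ s ∧
      torsionCode p i C = (Ideal.span {xSubOne (IsLocalRing.ResidueField R) (p ^ s) ^
        torsionalDegree p i C} : Set _)) ∧
    -- the torsional degrees of the forms
    (∀ k, k < p ^ s → ∀ C : Ideal (CyclicAmbient R (p ^ s)),
      C = Ideal.span {xSubOne R (p ^ s) ^ k} →
      torsionalDegree p 0 C = k ∧ torsionalDegree p 1 C = min k (p ^ (s - 1))) ∧
    (∀ (k l : ℕ) (η : ℕ → R), k < p ^ s → IsDeltaCoeff p m k l η →
      ∀ C : Ideal (CyclicAmbient R (p ^ s)),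
      C = Ideal.span {xSubOne R (p ^ s) ^ k +
        p * xSubOne R (p ^ s) ^ l * deltaPoly (p ^ s) k l η} →
      torsionalDegree p 0 C = k ∧
      (p ^ (s - 1) ≠ p ^ s - k + l →
        torsionalDegree p 1 C = min k (min (p ^ (s - 1)) (p ^ s - k + l))) ∧
      (p ^ (s - 1) = p ^ s - k + l →
        torsionalDegree p 1 C = min k (p ^ (s - 1) + firstDiff p m s η))) ∧
    (∀ k n : ℕ, k < p ^ s → n < k → ∀ C : Ideal (CyclicAmbient R (p ^ s)),
      C = Ideal.span {xSubOne R (p ^ s) ^ k, p * xSubOne R (p ^ s) ^ n} →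
      torsionalDegree p 0 C = k ∧
      torsionalDegree p 1 C = min k (min (p ^ (s - 1)) n)) ∧
    (∀ (k l n : ℕ) (η : ℕ → R), k < p ^ s → n < k → IsDeltaCoeff p m k l η →
      ∀ C : Ideal (CyclicAmbient R (p ^ s)),
      C = Ideal.span {xSubOne R (p ^ s) ^ k +
        p * xSubOne R (p ^ s) ^ l * deltaPoly (p ^ s) k l η,
        p * xSubOne R (p ^ s) ^ n} →
      torsionalDegree p 0 C = k ∧
      (p ^ (s - 1) ≠ p ^ s - k + l →
        torsionalDegree p 1 C = min k (min (p ^ (s - 1)) (min (p ^ s - k + l) n))) ∧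
      (p ^ (s - 1) = p ^ s - k + l →
        torsionalDegree p 1 C = min k (min (p ^ (s - 1) + firstDiff p m s η) n))) ∧
    (∀ n, n < p ^ s → ∀ C : Ideal (CyclicAmbient R (p ^ s)),
      C = Ideal.span {(p : CyclicAmbient R (p ^ s)) * xSubOne R (p ^ s) ^ n} →
      torsionalDegree p 0 C = p ^ s ∧ torsionalDegree p 1 C = n) ∧
    -- the Hamming distance is that of a cyclic code over the residue field
    (∀ C : Ideal (CyclicAmbient R (p ^ s)), C ≠ ⊥ →
      hammingDistance C = hammingDistance
        (Ideal.span {xSubOne (IsLocalRing.ResidueField R) (p ^ s) ^ torsionalDegree p 1 C})) ∧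
    -- the explicit Hamming distance of the codes over the residue field
    (∀ (i d : ℕ), d = hammingDistance
        (Ideal.span {xSubOne (IsLocalRing.ResidueField R) (p ^ s) ^ i}) →
      (i = 0 → d = 1) ∧
      (1 ≤ i → i ≤ p ^ (s - 1) → d = 2) ∧
      (∀ β, 1 ≤ β → β ≤ p - 2 →
        β * p ^ (s - 1) + 1 ≤ i → i ≤ (β + 1) * p ^ (s - 1) → d = β + 2) ∧
      (∀ τ k, 1 ≤ τ → τ ≤ p - 1 → 1 ≤ k → k ≤ s - 1 →
        p ^ s - p ^ (s - k) + (τ - 1) * p ^ (s - k - 1) + 1 ≤ i →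
        i ≤ p ^ s - p ^ (s - k) + τ * p ^ (s - k - 1) → d = (τ + 1) * p ^ k)) := by
  obtain ⟨t, rfl⟩ := Nat.exists_eq_add_of_le' hs
  have := (hR.isSquareZeroReduction hp).charP_residueField hp
  have := Fact.mk hp
  simp only [Nat.add_sub_cancel]
  exact ⟨fun C => (hR.ideal_forms hp C).imp_right Or.inr,
    fun C i _ => ⟨(torsionalDegree_spec i C).1, torsionCode_eq_span i C⟩,
    fun _ hk _ hC => hR.torsionalDegree_span_pow hp hk.le hC,
    fun _ _ _ hk hη _ hC => hR.torsionalDegree_span_delta hp hk.le hη hC,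
    fun _ _ hk _ _ hC => hR.torsionalDegree_span_pow_pair hp hk.le hC,
    fun _ _ _ _ hk _ hη _ hC => hR.torsionalDegree_span_delta_pair hp hk.le hη hC,
    fun _ hn _ hC => (hR.isSquareZeroReduction hp).torsionalDegree_span_natCast_mul hp hn.le hC,
    fun C _ => hR.hammingDistance_eq_span hp C,
    fun _ _ hd => hammingDistance_span_pow_eq hd⟩
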